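/- **Setting.** An instance $\mathfrak I$ with price interval $[0,1]$ consists of a context space $\mathcal C$, a utility map $\mu_*$, an exogenous law of a context sequence $(c_t)_{t\ge1}$ in $\mathcal C$, a mean-zero noise law with distribution function $F$, and an interval $\mathcal U=[u_{\min},u_{\max}]$. The noises $\xi_t$ are i.i.d. from $F$, and the context sequence, the noise sequence and the seller's internal randomization are independent. In round $t$ the seller sees $c_t$, posts a price $p_t\in[0,1]$ that depends measurably on the past contexts, prices and outcomes, on $c_t$ and on the internal randomization, and observes $y_t=\mathbf 1\{\mu_*(c_t)+\xi_t\ge p_t\}$. Any such rule is a pricing policy $\pi$. Put $g=1-F$, $r(u,p)=p\,g(p-u)$, and $$\mathrm{Regret}^{\mathfrak I}_\pi(T)=\mathbb E\sum_{t=1}^T\Big(\max_{p\in[0,1]}r(\mu_*(c_t),p)-r(\mu_*(c_t),p_t)\Big).$$ Given $\beta\ge2$, constants $L_g>0$, $0<\sigma_r\le L_r$ and an interval $\mathcal U=[u_{\min},u_{\max}]\subseteq[0,1]$ with $u_{\min}<u_{\max}$, the instance $\mathfrak I$ is called a lower-bound-normalized linear instance if $\mathcal C\subseteq[0,1]$,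 $\mu_*(c)=c$ (dimension one, parameter $\theta_*=1$), its supplied interval is $\mathcal U$, $\mu_*(c)+\xi\in[0,1]$ almost surely for each $c\in\mathcal C$, and: 1. (boundedness) $\mu_*(c)\in\mathcal U$ for all $c\in\mathcal C$; 2. (Hölder smoothness) with $V=1+\max\{|u_{\min}|,|u_{\max}|\}$, the tail $g$ is $\lfloor\beta\rfloor$ times continuously differentiable on $[-V,V]$, $|g^{(k)}|\le L_g$ there for $1\le k\le\lfloor\beta\rfloor$, and $\big|g(z')-\sum_{k=0}^{\lfloor\beta\rfloor}\frac{(z'-z)^k}{k!}g^{(k)}(z)\big|\le L_g|z'-z|^\beta$ for all $z,z'\in[-V,V]$; 3. (strong unimodality) for each $u\in\mathcal U$, $r(u,\cdot)$ has a unique maximizer $p^*(u)$ on $[0,1]$, it lies in $(0,1)$, and $\frac{\sigma_r}2|p-p^*(u)|^2\le r(u,p^*(u))-r(u,p)\le\frac{L_r}2|p-p^*(u)|^2$ for all $p\in[0,1]$; 4. (local concavity radius at least $1/16$) for some $\rho\ge1/16$ and all $u\in\mathcal U$, $[p^*(u)-\rho,p^*(u)+\rho]\subset(0,1)$ and $-\partial_p^2r(u,p)\ge\sigma_r/2$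 whenever $|p-p^*(u)|\le\rho$. **Theorem 2 (Lower bound).** Fix $\beta\ge2$. There are $c_\beta>0$, structural constants $L_g,\sigma_r,L_r$, an interval $\mathcal U$, and $T_0$, all independent of $T$ and of the policy, such that for every $T\ge T_0$ and every pricing policy $\pi$ there is a lower-bound-normalized linear instance $\mathfrak I$ (with these constants and this interval) with $$\mathrm{Regret}^{\mathfrak I}_\pi(T)\ \ge\ c_\beta\,T^{\frac{2\beta-1}{4\beta-3}}.$$ Equivalently, the minimax regret $\inf_\pi\sup_{\mathfrak I}\mathrm{Regret}^{\mathfrak I}_\pi(T)$ over these instances is at least $c_\beta T^{\frac{2\beta-1}{4\beta-3}}$ for every $T\ge T_0$. -/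

import Mathlib

open MeasureTheory ProbabilityTheory Set

universe u v

noncomputable section

/-- A contextual pricing instance with contexts in `X` and prices in `[0, pmax]`.
The whole context sequence has an arbitrary exogenous law; the valuation noises are i.i.d. with
law `noise`; the interval `[umin, umax]` is the scalar-index interval supplied with the instance. -/
structure PricingInstance (X : Type v) [MeasurableSpace X] (pmax : ℝ) where
  /-- the context space -/
  contextSpace : Set X
  /-- the deterministic utility map -/
  utility : X → ℝ
  measurable_utility : Measurable utility
  /-- left end of the scalar-index interval -/
  umin : ℝ
  /-- right end of the scalar-index interval -/
  umax : ℝ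
  /-- the law of one valuation noise -/
  noise : Measure ℝ
  isProbabilityMeasure_noise : IsProbabilityMeasure noise
  /-- the joint law of the sequence of contexts -/
  contextLaw : Measure (ℕ → X)
  isProbabilityMeasure_contextLaw : IsProbabilityMeasure contextLaw
  contextLaw_mem : ∀ᵐ x ∂contextLaw, ∀ t, x t ∈ contextSpace

attribute [instance] PricingInstance.isProbabilityMeasure_noise
  PricingInstance.isProbabilityMeasure_contextLaw

/-- A (possibly randomized) non-anticipating pricing policy. Rounds are numbered from `0`. In round
`t` it posts a price in `[0, pmax]` that depends measurably on its private random seed, on the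
contexts of the rounds `0, …, t` and on the purchase indicators of the rounds `0, …, t - 1`
(past prices are functions of the same data, so they need not be listed). -/
structure PricingPolicy (X : Type v) [MeasurableSpace X] (pmax : ℝ) where
  /-- the space of the internal randomization -/
  Seed : Type u
  measurableSpace_seed : MeasurableSpace Seed
  /-- the law of the internal randomization -/
  seedLaw : Measure Seed
  isProbabilityMeasure_seedLaw : IsProbabilityMeasure seedLaw
  /-- the price posted in round `t` -/
  price : (t : ℕ) → Seed → (Fin (t + 1) → X) → (Fin t → Bool) → ℝ
  price_mem : ∀ t s x y, price t s x y ∈ Icc 0 pmax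
  measurable_price : ∀ t, Measurable
    (fun z : Seed × (Fin (t + 1) → X) × (Fin t → Bool) => price t z.1 z.2.1 z.2.2)

attribute [instance] PricingPolicy.measurableSpace_seed PricingPolicy.isProbabilityMeasure_seedLaw

namespace PricingInstance

variable {X : Type v} [MeasurableSpace X] {pmax : ℝ}

/-- The tail function `g = 1 - F` of the noise. -/
def tail (I : PricingInstance X pmax) (z : ℝ) : ℝ := 1 - cdf I.noise z

/-- The one-dimensional revenue function `r(u, p) = p g(p - u)`. -/
def indexRevenue (I : PricingInstance X pmax) (a p : ℝ) : ℝ := p * I.tail (p - a)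

/-- The expected revenue `R(c, p)` of price `p` at context `c`. -/
def revenue (I : PricingInstance X pmax) (c : X) (p : ℝ) : ℝ := I.indexRevenue (I.utility c) p

/-- The benchmark `max_{p ∈ [0, pmax]} R(c, p)`. -/
def optRevenue (I : PricingInstance X pmax) (c : X) : ℝ := sSup (I.revenue c '' Icc 0 pmax)

/-- The purchase indicators of the rounds `0, …, t - 1` when policy `π` with seed `s` faces the
contexts `x` and the noises `ξ`: the customer of round `t` buys iff her valuation
`utility (x t) + ξ t` is at least the posted price. -/
def outcomes (I : PricingInstance X pmax) (π : PricingPolicy.{u, v} X pmax) (s : π.Seed)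
    (x : ℕ → X) (ξ : ℕ → ℝ) : (t : ℕ) → Fin t → Bool
  | 0 => Fin.elim0
  | t + 1 => Fin.snoc (α := fun _ => Bool) (outcomes I π s x ξ t)
      (decide (π.price t s (fun i => x i) (outcomes I π s x ξ t) ≤ I.utility (x t) + ξ t))

/-- The price posted by `π` in round `t`. -/
def postedPrice (I : PricingInstance X pmax) (π : PricingPolicy.{u, v} X pmax) (s : π.Seed)
    (x : ℕ → X) (ξ : ℕ → ℝ) (t : ℕ) : ℝ :=
  π.price t s (fun i => x i) (I.outcomes π s x ξ t)

/-- The joint law of the context sequence, the noise sequence and the seed of the policy: the three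
are independent and the noises are i.i.d. -/
def jointLaw (I : PricingInstance X pmax) (π : PricingPolicy.{u, v} X pmax) :
    Measure ((ℕ → X) × (ℕ → ℝ) × π.Seed) :=
  I.contextLaw.prod ((Measure.infinitePi (fun _ : ℕ => I.noise)).prod π.seedLaw)

/-- The expected regret of `π` over the first `T` rounds. -/
def regret (I : PricingInstance X pmax) (π : PricingPolicy.{u, v} X pmax) (T : ℕ) : ℝ :=
  ∫ z, ∑ t ∈ Finset.range T,
    (I.optRevenue (z.1 t) - I.revenue (z.1 t) (I.postedPrice π z.2.2 z.1 z.2.1 t)) ∂(I.jointLaw π)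

/-- Boundedness: the utility takes values in the nondegenerate interval `[umin, umax]`. -/
def Bounded (I : PricingInstance X pmax) : Prop :=
  I.umin < I.umax ∧ ∀ c ∈ I.contextSpace, I.utility c ∈ Icc I.umin I.umax

/-- The half-length `V` of the interval on which smoothness of the tail is required. -/
def halfLength (I : PricingInstance X pmax) : ℝ := pmax + max |I.umin| |I.umax|

/-- The interval `[-V, V]`. -/
def gapInterval (I : PricingInstance X pmax) : Set ℝ := Icc (-I.halfLength) I.halfLength

/-- `β`-Hölder smoothness of the tail function on `[-V, V]` with constant `Lg`. -/
def HolderTail (I : PricingInstance X pmax) (β Lg : ℝ) : Prop :=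
  0 < Lg ∧ 2 ≤ β ∧
  ContDiffOn ℝ (⌊β⌋₊ : ℕ) I.tail I.gapInterval ∧
  (∀ k : ℕ, 1 ≤ k → k ≤ ⌊β⌋₊ → ∀ z ∈ I.gapInterval,
    |iteratedDerivWithin k I.tail I.gapInterval z| ≤ Lg) ∧
  ∀ z ∈ I.gapInterval, ∀ z' ∈ I.gapInterval,
    |I.tail z' - ∑ k ∈ Finset.range (⌊β⌋₊ + 1),
      (z' - z) ^ k / (k.factorial : ℝ) * iteratedDerivWithin k I.tail I.gapInterval z|
      ≤ Lg * |z' - z| ^ β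

/-- `q` maximizes `p ↦ r(a, p)` over `[0, pmax]`. -/
def IsOraclePrice (I : PricingInstance X pmax) (a q : ℝ) : Prop :=
  q ∈ Icc 0 pmax ∧ IsMaxOn (I.indexRevenue a) (Icc 0 pmax) q

/-- Strong unimodality with constants `σr ≤ Lr`: at every index in `[umin, umax]` the maximizer of
the revenue is unique and interior, and the revenue loss is of quadratic growth around it. -/
def StronglyUnimodal (I : PricingInstance X pmax) (σr Lr : ℝ) : Prop :=
  0 < σr ∧ σr ≤ Lr ∧ ∀ a ∈ Icc I.umin I.umax,
    (∃! q, I.IsOraclePrice a q) ∧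
    ∀ q, I.IsOraclePrice a q → q ∈ Ioo 0 pmax ∧
      ∀ p ∈ Icc 0 pmax,
        σr / 2 * |p - q| ^ 2 ≤ I.indexRevenue a q - I.indexRevenue a p ∧
        I.indexRevenue a q - I.indexRevenue a p ≤ Lr / 2 * |p - q| ^ 2

/-- `ρ` is a local-concavity radius, relative to the curvature constant `σr`. -/
def IsLocalConcavityRadius (I : PricingInstance X pmax) (σr ρ : ℝ) : Prop :=
  0 < ρ ∧ ∀ a ∈ Icc I.umin I.umax, ∀ q, I.IsOraclePrice a q →
    Icc (q - ρ) (q + ρ) ⊆ Ioo 0 pmax ∧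
    ∀ p, |p - q| ≤ ρ → σr / 2 ≤ -iteratedDeriv 2 (I.indexRevenue a) p

/-- The linear utility model in dimension one with parameter `θ` and parameter bound `Cθ`. -/
def LinearUtility (I : PricingInstance ℝ pmax) (Cθ θ : ℝ) : Prop :=
  0 < Cθ ∧ I.contextSpace ⊆ Metric.closedBall 0 1 ∧ |θ| ≤ Cθ ∧
  (∀ c ∈ I.contextSpace, 0 ≤ c * θ) ∧ ∀ c ∈ I.contextSpace, I.utility c = c * θ

/-- Lower-bound-normalized one-dimensional linear instances (`pmax = 1`, `Cθ = θ = 1`), with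
structural constants `Lg, σr, Lr` and supplied scalar-index interval `[umin, umax] ⊆ [0, 1]`. Fixing
these numbers for a whole class of instances expresses that the structural constants are bounded
above, and below away from zero, uniformly over the class. -/
structure IsLowerBoundNormalized (β Lg σr Lr a b : ℝ) (I : PricingInstance ℝ 1) : Prop where
  linear : I.LinearUtility 1 1
  context_subset : I.contextSpace ⊆ Icc 0 1
  integrable_noise : Integrable (fun ξ : ℝ => ξ) I.noise
  mean_noise : ∫ ξ, ξ ∂I.noise = 0
  valuation_mem : ∀ c ∈ I.contextSpace, ∀ᵐ ξ ∂I.noise, I.utility c + ξ ∈ Icc (0 : ℝ) 1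
  umin_eq : I.umin = a
  umax_eq : I.umax = b
  interval_subset : Icc I.umin I.umax ⊆ Icc 0 1
  bounded : I.Bounded
  holder : I.HolderTail β Lg
  unimodal : I.StronglyUnimodal σr Lr
  concavity : ∃ ρ, 1 / 16 ≤ ρ ∧ I.IsLocalConcavityRadius σr ρ

end PricingInstance

end

/-! Start from a noise whose tail is affine of slope `-1` around the origin, so that at context `a`
the revenue is the parabola `p * (1/2 + a - p)` with maximizer `1/4 + a/2`. Add `K` odd bumps of
width `h` of order `1/K` and height of order `h ^ β`, with disjoint supports and hidden signs. This
height keeps the Hölder constant bounded uniformly in `K`. A bump vanishes at its centre but has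
slope `±d` there, with `d = ε * h ^ (β - 1)`. At the context where the unperturbed optimal price
probes exactly that centre, the sign moves the optimal price by order `d` up or down, while the sale
probability at the unperturbed price does not depend on any sign.

Information therefore has to be bought. Pricing at distance `e` from the unperturbed optimum changes
the sale probability by at most `2 * d * |e|` under the flip of a sign, whichever bump is probed
(`sum_wiggle_sq_le`), so it yields information of order `d² e²`. It also costs regret at least
`e²/160 - d²/80`. Not knowing a sign costs order `d²` in every round devoted to it
(`firstOrder_wiggleSum`).

The contexts visit the bumps in round-robin order, so each sign matters in about `T/K` rounds. If
the regret were well below `d² T`, the total information would be of order `d⁴ T`, that is `d⁴ T /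
K` per sign. When `d⁴ T` is at most a small multiple of `K` this is too little to learn a typical
sign, and the regret is of order `d² T` after all. `assouad_tree` makes this self-bounding argument
precise, with the two-point bound `tree_test_error` obtained from Bhattacharyya affinities of
adaptive coin flips. `regret_eq_integral_treeExp` links the pricing model to such coin flips, with
the seed frozen.

Since `d` is of order `K ^ (-(β - 1))`, the constraint reads `T ≲ K ^ (4β - 3)`. Taking `K` of order
`T ^ (1 / (4β - 3))` turns `d² T` into `T ^ ((2β - 1) / (4β - 3))`. -/

open scoped ContDiff

noncomputable section

/-! ### Taylor remainders and Hölder bounds -/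

/-- **Taylor's theorem** with Lagrange remainder for a globally smooth function. -/
theorem exists_taylor_remainder {f : ℝ → ℝ} (hf : ContDiff ℝ ∞ f) (n : ℕ) (x y : ℝ) :
    ∃ ξ, f y - ∑ k ∈ Finset.range (n + 1), (y - x) ^ k / (k.factorial : ℝ) * iteratedDeriv k f x
      = iteratedDeriv (n + 1) f ξ * (y - x) ^ (n + 1) / ((n + 1).factorial : ℝ) := by
  rcases eq_or_ne x y with rfl | hxy
  · refine ⟨x, ?_⟩
    rw [Finset.sum_range_succ']
    simp
  · have hf' : ContDiff ℝ (n + 1) f := hf.of_le (by exact_mod_cast le_top)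
    obtain ⟨ξ, -, h⟩ := taylor_mean_remainder_lagrange_iteratedDeriv (n := n) hxy hf'.contDiffOn
    refine ⟨ξ, ?_⟩
    rw [← h, taylor_within_apply]
    congr 1
    refine Finset.sum_congr rfl fun k hk => ?_
    rw [iteratedDerivWithin_eq_iteratedDeriv (uniqueDiffOn_uIcc hxy)
      (hf.of_le (by exact_mod_cast le_top)).contDiffAt left_mem_uIcc, smul_eq_mul]
    ring

/-- Interpolating between two consecutive derivative bounds gives a Hölder bound, uniform in the
scale `h`, on the Taylor remainder of order `⌊β⌋`. -/
theorem abs_taylor_remainder_le_rpow {f : ℝ → ℝ} (hf : ContDiff ℝ ∞ f) {β M h : ℝ} (hβ : 1 ≤ β)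
    (hM : 0 ≤ M) (hh : 0 < h)
    (h₀ : ∀ z, |iteratedDeriv ⌊β⌋₊ f z| ≤ M * h ^ (β - ⌊β⌋₊))
    (h₁ : ∀ z, |iteratedDeriv (⌊β⌋₊ + 1) f z| ≤ M * h ^ (β - (⌊β⌋₊ + 1))) (x y : ℝ) :
    |f y - ∑ k ∈ Finset.range (⌊β⌋₊ + 1),
      (y - x) ^ k / (k.factorial : ℝ) * iteratedDeriv k f x| ≤ 2 * M * |y - x| ^ β := by
  have hn1 : 1 ≤ ⌊β⌋₊ := Nat.le_floor (by exact_mod_cast hβ)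
  have hnβ : (⌊β⌋₊ : ℝ) ≤ β := Nat.floor_le (by linarith)
  have hβn : β < ⌊β⌋₊ + 1 := Nat.lt_floor_add_one β
  obtain ⟨m, hm⟩ : ∃ m, ⌊β⌋₊ = m + 1 := ⟨⌊β⌋₊ - 1, by omega⟩
  generalize hn : ⌊β⌋₊ = n at *
  have hfac : ∀ j : ℕ, (1 : ℝ) ≤ (j.factorial : ℝ) := fun j => by
    exact_mod_cast Nat.one_le_iff_ne_zero.2 j.factorial_ne_zero
  have hpow : 0 ≤ |y - x| ^ β := by positivity
  have hterm : ∀ (j : ℕ) (a B : ℝ), |a| ≤ B →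
      |a * (y - x) ^ j / (j.factorial : ℝ)| ≤ B * |y - x| ^ j := fun j a B hB => by
    rw [abs_div, abs_mul, abs_pow, Nat.abs_cast]
    refine (div_le_self (by positivity) (hfac j)).trans ?_
    gcongr
  rcases eq_or_ne y x with rfl | hyx
  · rw [Finset.sum_range_succ']
    simpa using by positivity
  have hpos : 0 < |y - x| := abs_pos.2 (sub_ne_zero.2 hyx)
  -- Increments shorter than the scale `h` use the bound on the derivative of order `n + 1`; longer
  -- ones use the bound of order `n`. In both cases the surplus power of `h` is traded for a power
  -- of `|y - x|` in the favourable direction.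
  rcases le_total |y - x| h with hle | hle
  · obtain ⟨ξ, hξ⟩ := exists_taylor_remainder hf n x y
    rw [hξ]
    refine (hterm _ _ _ (h₁ ξ)).trans ?_
    have e : |y - x| ^ (n + 1) = |y - x| ^ β * |y - x| ^ ((n + 1 : ℝ) - β) := by
      rw [← Real.rpow_add hpos, ← Real.rpow_natCast]
      congr 1
      push_cast
      ring
    have e2 : |y - x| ^ ((n + 1 : ℝ) - β) ≤ h ^ ((n + 1 : ℝ) - β) :=
      Real.rpow_le_rpow hpos.le hle (by linarith)
    have e3 : h ^ (β - (n + 1 : ℝ)) * h ^ ((n + 1 : ℝ) - β) = 1 := by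
      rw [← Real.rpow_add hh]
      simp
    calc M * h ^ (β - (n + 1 : ℝ)) * |y - x| ^ (n + 1)
        ≤ M * h ^ (β - (n + 1 : ℝ)) * (|y - x| ^ β * h ^ ((n + 1 : ℝ) - β)) := by
          rw [e]
          gcongr
      _ = M * |y - x| ^ β * (h ^ (β - (n + 1 : ℝ)) * h ^ ((n + 1 : ℝ) - β)) := by ring
      _ ≤ 2 * M * |y - x| ^ β := by
          rw [e3]
          nlinarith [mul_nonneg hM hpow]
  -- Expanding one order lower leaves a remainder of order `n`; the `n`-th Taylor term is then
  -- estimated separately, which is where the factor `2` comes from.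
  · obtain ⟨ξ, hξ⟩ := exists_taylor_remainder hf m x y
    rw [Finset.sum_range_succ]
    rw [← hm] at hξ
    have e : |y - x| ^ n * h ^ (β - n) ≤ |y - x| ^ β := by
      calc |y - x| ^ n * h ^ (β - n) ≤ |y - x| ^ n * |y - x| ^ (β - n) := by
            gcongr
        _ = |y - x| ^ β := by
            rw [← Real.rpow_natCast, ← Real.rpow_add hpos]
            congr 1
            ring
    have b1 := hterm n _ _ (h₀ ξ)
    have b2 := hterm n _ _ (h₀ x)
    have e4 := mul_le_mul_of_nonneg_left e hM
    rw [← sub_sub, hξ]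
    refine (abs_sub _ _).trans ?_
    have : (y - x) ^ n / (n.factorial : ℝ) * iteratedDeriv n f x
        = iteratedDeriv n f x * (y - x) ^ n / (n.factorial : ℝ) := by ring
    rw [this]
    nlinarith

/-- The derivatives of a compactly supported smooth function are bounded. -/
theorem exists_bound_iteratedDeriv {f : ℝ → ℝ} (hf : ContDiff ℝ ∞ f) (hc : HasCompactSupport f)
    (n : ℕ) : ∃ C, ∀ z, |iteratedDeriv n f z| ≤ C := by
  have hs : HasCompactSupport (iteratedDeriv n f) := by
    induction n with
    | zero => simpa using hc
    | succ n ih =>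
      rw [iteratedDeriv_succ]
      exact ih.deriv
  exact (hf.continuous_iteratedDeriv n (by exact_mod_cast le_top)).bounded_above_of_compact_support hs

theorem iteratedDeriv_eq_zero_of_notMem_tsupport {f : ℝ → ℝ} {x : ℝ} (hx : x ∉ tsupport f)
    (n : ℕ) : iteratedDeriv n f x = 0 := by
  have h : f =ᶠ[nhds x] fun _ => 0 := notMem_tsupport_iff_eventuallyEq.1 hx
  rw [h.iteratedDeriv_eq n]
  simp

/-! ### The unperturbed tail -/

/-- A smooth tail function which is affine of slope `-1` on `[-3/8, 3/8]`, equals `1` on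
`(-∞, -7/16]` and equals `0` on `[7/16, ∞)`. -/
def rampTail (z : ℝ) : ℝ :=
  1 - Real.smoothTransition (7 + 16 * z) * (1 - Real.smoothTransition (7 - 16 * z) * (1 / 2 - z))

namespace rampTail

theorem contDiff : ContDiff ℝ ∞ rampTail := by
  have h : ContDiff ℝ ∞ Real.smoothTransition := Real.smoothTransition.contDiff
  have h1 : ContDiff ℝ ∞ fun z : ℝ => Real.smoothTransition (7 + 16 * z) :=
    h.comp (by fun_prop)
  have h2 : ContDiff ℝ ∞ fun z : ℝ => Real.smoothTransition (7 - 16 * z) :=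
    h.comp (by fun_prop)
  unfold rampTail
  fun_prop

theorem eq_of_neg_le {z : ℝ} (hz : -(3 / 8) ≤ z) :
    rampTail z = Real.smoothTransition (7 - 16 * z) * (1 / 2 - z) := by
  rw [rampTail, Real.smoothTransition.one_of_one_le (x := 7 + 16 * z) (by linarith)]
  ring

theorem eq_of_le {z : ℝ} (hz : z ≤ 3 / 8) :
    rampTail z = 1 - Real.smoothTransition (7 + 16 * z) * (1 / 2 + z) := by
  rw [rampTail, Real.smoothTransition.one_of_one_le (x := 7 - 16 * z) (by linarith)]
  ring

theorem eq_of_abs_le {z : ℝ} (hz : |z| ≤ 3 / 8) : rampTail z = 1 / 2 - z := by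
  rw [abs_le] at hz
  rw [eq_of_neg_le hz.1, Real.smoothTransition.one_of_one_le (by linarith), one_mul]

theorem eq_one {z : ℝ} (hz : z ≤ -(7 / 16)) : rampTail z = 1 := by
  rw [rampTail, Real.smoothTransition.zero_of_nonpos (x := 7 + 16 * z) (by linarith)]
  ring

theorem eq_zero {z : ℝ} (hz : 7 / 16 ≤ z) : rampTail z = 0 := by
  rw [eq_of_neg_le (by linarith), Real.smoothTransition.zero_of_nonpos (by linarith), zero_mul]

/-- This symmetry transfers monotonicity from the right half-line to the left one and gives the
integral that makes the noise centred. -/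
theorem add_neg (z : ℝ) : rampTail z + rampTail (-z) = 1 := by
  rcases le_total z 0 with h | h
  · rw [eq_of_le (by linarith), eq_of_neg_le (by linarith)]
    ring_nf
  · rw [eq_of_neg_le (by linarith), eq_of_le (by linarith)]
    ring_nf

theorem antitoneOn_Ici : AntitoneOn rampTail (Ici (1 / 16)) := by
  intro x hx y hy hxy
  rw [mem_Ici] at hx hy
  rw [eq_of_neg_le (by linarith), eq_of_neg_le (by linarith)]
  rcases le_total y (7 / 16) with h | h
  · exact mul_le_mul (Real.smoothTransition.monotone (by linarith)) (by linarith) (by linarith)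
      (Real.smoothTransition.nonneg _)
  · rw [Real.smoothTransition.zero_of_nonpos (x := 7 - 16 * y) (by linarith), zero_mul]
    rcases le_total x (7 / 16) with h' | h'
    · exact mul_nonneg (Real.smoothTransition.nonneg _) (by linarith)
    · rw [Real.smoothTransition.zero_of_nonpos (x := 7 - 16 * x) (by linarith), zero_mul]

theorem antitoneOn_Iic : AntitoneOn rampTail (Iic (-(1 / 16))) := by
  intro x hx y hy hxy
  rw [mem_Iic] at hx hy
  have := antitoneOn_Ici (a := -y) (b := -x) (by rw [mem_Ici]; linarith)
    (by rw [mem_Ici]; linarith) (by linarith)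
  linarith [add_neg x, add_neg y]

/-- Order zero is excluded because the tail itself is not compactly supported; its derivative is,
being zero off `[-7/16, 7/16]`. -/
theorem exists_bound (n : ℕ) : ∃ C, ∀ z, |iteratedDeriv (n + 1) rampTail z| ≤ C := by
  have hd : ContDiff ℝ ∞ (deriv rampTail) := by
    have := rampTail.contDiff
    rw [contDiff_infty_iff_deriv] at this
    exact this.2
  have hc : HasCompactSupport (deriv rampTail) := by
    refine HasCompactSupport.of_support_subset_isCompact (isCompact_Icc (a := -(7 / 16)) (b := 7 / 16))
      fun z hz => ?_
    by_contra hz'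
    apply hz
    rw [mem_Icc, not_and_or, not_le, not_le] at hz'
    rcases hz' with h | h
    · have : rampTail =ᶠ[nhds z] fun _ => 1 :=
        Filter.eventually_of_mem (Iio_mem_nhds h) fun w hw => eq_one (le_of_lt hw)
      rw [this.deriv_eq, deriv_const]
    · have : rampTail =ᶠ[nhds z] fun _ => 0 :=
        Filter.eventually_of_mem (Ioi_mem_nhds h) fun w hw => eq_zero (le_of_lt hw)
      rw [this.deriv_eq, deriv_const]
  obtain ⟨C, hC⟩ := exists_bound_iteratedDeriv hd hc n
  exact ⟨C, fun z => by rw [iteratedDeriv_succ']; exact hC z⟩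

theorem integral_eq : ∫ z in (-(7 / 16) : ℝ)..(7 / 16), rampTail z = 7 / 16 := by
  have h := intervalIntegral.integral_comp_neg (a := -(7 / 16)) (b := 7 / 16) rampTail
  have hi : ∀ a b : ℝ, IntervalIntegrable rampTail volume a b :=
    fun a b => rampTail.contDiff.continuous.intervalIntegrable a b
  have h1 : ∫ z in (-(7 / 16) : ℝ)..(7 / 16), rampTail (-z)
      = ∫ z in (-(7 / 16) : ℝ)..(7 / 16), (1 - rampTail z) :=
    intervalIntegral.integral_congr fun z _ => by linarith [add_neg z]
  rw [intervalIntegral.integral_sub (by simp) (hi _ _)] at h1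
  rw [h1] at h
  simp only [neg_neg, intervalIntegral.integral_const, smul_eq_mul, mul_one] at h
  linarith

end rampTail

/-! ### Admissible perturbations and the resulting noise law -/

/-- Small smooth mean-zero perturbations of a tail function, supported near the origin. -/
structure IsSmallPerturbation (P : ℝ → ℝ) : Prop where
  contDiff : ContDiff ℝ ∞ P
  abs_apply_le : ∀ z, |P z| ≤ 1 / 2048
  abs_deriv_le : ∀ z, |deriv P z| ≤ 1 / 2048
  abs_deriv_deriv_le : ∀ z, |deriv (deriv P) z| ≤ 1 / 2048
  eq_zero : ∀ z, 1 / 16 ≤ |z| → P z = 0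
  integral_eq_zero : ∫ z, P z = 0

namespace IsSmallPerturbation

variable {P : ℝ → ℝ}

theorem contDiff_deriv (hP : IsSmallPerturbation P) : ContDiff ℝ ∞ (deriv P) := by
  have := hP.contDiff
  rw [contDiff_infty_iff_deriv] at this
  exact this.2

theorem deriv_deriv_eq_zero (hP : IsSmallPerturbation P) {z : ℝ} (hz : 1 / 16 < |z|) :
    deriv (deriv P) z = 0 := by
  have h : P =ᶠ[nhds z] fun _ => 0 :=
    Filter.eventually_of_mem ((isOpen_lt continuous_const continuous_abs).mem_nhds hz)
      fun w hw => hP.eq_zero w (le_of_lt hw)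
  have h' : deriv P =ᶠ[nhds z] fun _ => 0 := by simpa using h.deriv
  rw [h'.deriv_eq, deriv_const]

/-- On `[-1/16, 1/16]` the base has slope `-1`, which dominates the slope of `P`; outside, `P`
vanishes and the base is antitone by itself. -/
theorem antitone (hP : IsSmallPerturbation P) : Antitone fun z => rampTail z + P z := by
  have h1 : AntitoneOn (fun z => rampTail z + P z) (Iic (-(1 / 16))) := fun x hx y hy hxy => by
    rw [mem_Iic] at hx hy
    have := rampTail.antitoneOn_Iic hx hy hxy
    simp only [hP.eq_zero x (by rw [abs_of_nonpos] <;> linarith),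
      hP.eq_zero y (by rw [abs_of_nonpos] <;> linarith)]
    linarith
  have h2 : AntitoneOn (fun z => rampTail z + P z) (Ici (1 / 16)) := fun x hx y hy hxy => by
    rw [mem_Ici] at hx hy
    have := rampTail.antitoneOn_Ici hx hy hxy
    simp only [hP.eq_zero x (by rw [abs_of_nonneg] <;> linarith),
      hP.eq_zero y (by rw [abs_of_nonneg] <;> linarith)]
    linarith
  have h3 : AntitoneOn (fun z => rampTail z + P z) (Icc (-(1 / 16)) (1 / 16)) := by
    intro x hx y hy hxy
    have hl : |P y - P x| ≤ 1 / 2048 * |y - x| := by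
      simpa using Convex.norm_image_sub_le_of_norm_deriv_le (𝕜 := ℝ) (s := univ) (f := P)
        (C := 1 / 2048) (fun z _ => (hP.contDiff.differentiable (by simp)) z)
        (fun z _ => hP.abs_deriv_le z) convex_univ (mem_univ x) (mem_univ y)
    rw [abs_of_nonneg (sub_nonneg.2 hxy)] at hl
    simp only [rampTail.eq_of_abs_le (z := x) (abs_le.2 ⟨by linarith [hx.1], by linarith [hx.2]⟩),
      rampTail.eq_of_abs_le (z := y) (abs_le.2 ⟨by linarith [hy.1], by linarith [hy.2]⟩)]
    linarith [(abs_le.1 hl).2]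
  have h4 := h1.union_right h3 (c := -(1 / 16)) isGreatest_Iic (isLeast_Icc (by norm_num))
  rw [Iic_union_Icc_eq_Iic (by norm_num)] at h4
  exact h4.Iic_union_Ici h2

end IsSmallPerturbation

/-- The distribution function `1 - (rampTail + P)`. -/
def perturbedCDF {P : ℝ → ℝ} (hP : IsSmallPerturbation P) : StieltjesFunction ℝ where
  toFun z := 1 - (rampTail z + P z)
  mono' := fun _ _ h => sub_le_sub_left (hP.antitone h) 1
  right_continuous' := fun x => by
    have h1 := rampTail.contDiff.continuous
    have h2 := hP.contDiff.continuous
    exact Continuous.continuousWithinAt (by fun_prop)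

section Noise

variable {P : ℝ → ℝ} (hP : IsSmallPerturbation P)

theorem perturbedCDF_apply (z : ℝ) : perturbedCDF hP z = 1 - (rampTail z + P z) := rfl

theorem perturbedCDF_eq_zero {z : ℝ} (hz : z ≤ -(7 / 16)) : perturbedCDF hP z = 0 := by
  rw [perturbedCDF_apply, rampTail.eq_one hz, hP.eq_zero z (by rw [abs_of_nonpos] <;> linarith)]
  ring

theorem perturbedCDF_eq_one {z : ℝ} (hz : 7 / 16 ≤ z) : perturbedCDF hP z = 1 := by
  rw [perturbedCDF_apply, rampTail.eq_zero hz, hP.eq_zero z (by rw [abs_of_nonneg] <;> linarith)]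
  ring

theorem tendsto_perturbedCDF_atBot :
    Filter.Tendsto (perturbedCDF hP) Filter.atBot (nhds 0) :=
  tendsto_const_nhds.congr' <| (Filter.eventually_le_atBot (-(7 / 16))).mono fun _ hz =>
    (perturbedCDF_eq_zero hP hz).symm

theorem tendsto_perturbedCDF_atTop :
    Filter.Tendsto (perturbedCDF hP) Filter.atTop (nhds 1) :=
  tendsto_const_nhds.congr' <| (Filter.eventually_ge_atTop (7 / 16)).mono fun _ hz =>
    (perturbedCDF_eq_one hP hz).symm

theorem continuous_perturbedCDF : Continuous (perturbedCDF hP) := by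
  have h1 := rampTail.contDiff.continuous
  have h2 := hP.contDiff.continuous
  change Continuous fun z => 1 - (rampTail z + P z)
  fun_prop

theorem isProbabilityMeasure_perturbedCDF : IsProbabilityMeasure (perturbedCDF hP).measure :=
  ⟨by rw [StieltjesFunction.measure_univ _ (tendsto_perturbedCDF_atBot hP)
    (tendsto_perturbedCDF_atTop hP)]; simp⟩

theorem perturbedCDF_real_Ioi (x : ℝ) :
    (perturbedCDF hP).measure.real (Ioi x) = rampTail x + P x := by
  have := isProbabilityMeasure_perturbedCDF hP
  have h := cdf_eq_real (perturbedCDF hP).measure x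
  rw [cdf_measure_stieltjesFunction _ (tendsto_perturbedCDF_atBot hP)
    (tendsto_perturbedCDF_atTop hP), perturbedCDF_apply] at h
  rw [← compl_Iic, probReal_compl_eq_one_sub measurableSet_Iic, ← h]
  ring

/-- The noise has no atoms. A sale occurs on a closed half-line of noises, whereas the tail `1 - F`
measures the open one. -/
theorem perturbedCDF_real_Ici (x : ℝ) :
    (perturbedCDF hP).measure.real (Ici x) = rampTail x + P x := by
  rw [← perturbedCDF_real_Ioi hP]
  have : NullSingletonClass (perturbedCDF hP).measure := ⟨fun a => by
    rw [StieltjesFunction.measure_singleton,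
      (continuous_perturbedCDF hP).continuousWithinAt.leftLim_eq]
    simp⟩
  exact measureReal_congr Ioi_ae_eq_Ici.symm

theorem perturbedCDF_ae_mem :
    ∀ᵐ ξ ∂(perturbedCDF hP).measure, ξ ∈ Icc (-(7 / 16) : ℝ) (7 / 16) := by
  have := isProbabilityMeasure_perturbedCDF hP
  have h : (perturbedCDF hP).measure (Icc (-(7 / 16) : ℝ) (7 / 16)) = 1 := by
    rw [StieltjesFunction.measure_Icc, (continuous_perturbedCDF hP).continuousWithinAt.leftLim_eq,
      perturbedCDF_eq_zero hP le_rfl, perturbedCDF_eq_one hP le_rfl]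
    simp
  exact (prob_compl_eq_zero_iff measurableSet_Icc).2 h

theorem integrable_perturbedCDF : Integrable (fun ξ : ℝ => ξ) (perturbedCDF hP).measure := by
  have := isProbabilityMeasure_perturbedCDF hP
  refine Integrable.of_bound (C := 7 / 16) (by fun_prop) ?_
  filter_upwards [perturbedCDF_ae_mem hP] with ξ hξ
  exact abs_le.2 hξ

/-- Layer-cake formula for the nonnegative variable `ξ + 7/16`: the base tail integrates to `7/16`
by symmetry and `P` integrates to zero. -/
theorem integral_perturbedCDF : ∫ ξ, ξ ∂(perturbedCDF hP).measure = 0 := by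
  have := isProbabilityMeasure_perturbedCDF hP
  have hi : Integrable (fun ξ : ℝ => ξ + 7 / 16) (perturbedCDF hP).measure :=
    (integrable_perturbedCDF hP).add (integrable_const _)
  have h := hi.integral_eq_integral_meas_lt (by
    filter_upwards [perturbedCDF_ae_mem hP] with ξ hξ
    simp only [Pi.zero_apply]
    linarith [hξ.1])
  rw [integral_add (integrable_perturbedCDF hP) (integrable_const _)] at h
  have h1 : ∀ t : ℝ, (perturbedCDF hP).measure.real {a | t < a + 7 / 16}
      = rampTail (t - 7 / 16) + P (t - 7 / 16) := fun t => by
    rw [← perturbedCDF_real_Ioi hP]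
    congr 1
    ext a
    simp only [mem_ofPred_eq, mem_Ioi]
    constructor <;> intro <;> linarith
  simp_rw [h1] at h
  have h2 : ∫ t in Ioi (0 : ℝ), (rampTail (t - 7 / 16) + P (t - 7 / 16))
      = ∫ t in (0 : ℝ)..(7 / 8), (rampTail (t - 7 / 16) + P (t - 7 / 16)) := by
    rw [intervalIntegral.integral_of_le (by norm_num)]
    refine setIntegral_eq_of_subset_of_forall_sdiff_eq_zero measurableSet_Ioi
      (fun t ht => ht.1) fun t ht => ?_
    have ht' : 7 / 8 < t := by
      by_contra hlt
      exact ht.2 ⟨ht.1, not_lt.1 hlt⟩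
    rw [rampTail.eq_zero (by linarith), hP.eq_zero _ (by rw [abs_of_nonneg] <;> linarith), zero_add]
  have h3 : ∫ z in (-(7 / 16) : ℝ)..(7 / 16), P z = 0 := by
    rw [intervalIntegral.integral_eq_integral_of_support_subset, hP.integral_eq_zero]
    intro z hz
    by_contra hz'
    refine hz (hP.eq_zero z ?_)
    by_contra hlt
    have := abs_lt.1 (not_le.1 hlt)
    exact hz' ⟨by linarith [this.1], by linarith [this.2]⟩
  rw [h2, intervalIntegral.integral_comp_sub_right (fun z => rampTail z + P z)] at h
  norm_num at h
  rw [intervalIntegral.integral_add (rampTail.contDiff.continuous.intervalIntegrable _ _)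
    (hP.contDiff.continuous.intervalIntegrable _ _), h3, rampTail.integral_eq] at h
  linarith

end Noise

section Instance

variable {P : ℝ → ℝ} (hP : IsSmallPerturbation P)

/-- The instance with tail `rampTail + P`, identity utility and deterministic contexts `x`. -/
def perturbedInstance (x : ℕ → ℝ) (hx : ∀ t, x t ∈ Icc (7 / 16 : ℝ) (9 / 16)) :
    PricingInstance ℝ 1 where
  contextSpace := Icc (7 / 16) (9 / 16)
  utility := id
  measurable_utility := measurable_id
  umin := 7 / 16
  umax := 9 / 16
  noise := (perturbedCDF hP).measure
  isProbabilityMeasure_noise := isProbabilityMeasure_perturbedCDF hP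
  contextLaw := Measure.dirac x
  isProbabilityMeasure_contextLaw := Measure.dirac.isProbabilityMeasure
  contextLaw_mem := by
    rw [ae_dirac_eq]
    exact hx

variable (x : ℕ → ℝ) (hx : ∀ t, x t ∈ Icc (7 / 16 : ℝ) (9 / 16))

theorem perturbedInstance_tail (z : ℝ) :
    (perturbedInstance hP x hx).tail z = rampTail z + P z := by
  change 1 - cdf (perturbedCDF hP).measure z = _
  rw [cdf_measure_stieltjesFunction _ (tendsto_perturbedCDF_atBot hP)
    (tendsto_perturbedCDF_atTop hP), perturbedCDF_apply]
  ring

theorem perturbedInstance_indexRevenue (a p : ℝ) :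
    (perturbedInstance hP x hx).indexRevenue a p = p * (rampTail (p - a) + P (p - a)) := by
  rw [PricingInstance.indexRevenue, perturbedInstance_tail]

end Instance

/-! ### Shape of the perturbed revenue -/

/-- The perturbation of the revenue at index `a`. -/
def revenuePerturbation (P : ℝ → ℝ) (a p : ℝ) : ℝ := p * P (p - a)

namespace IsSmallPerturbation

variable {P : ℝ → ℝ}

theorem hasDerivAt_revenuePerturbation (hP : IsSmallPerturbation P) (a p : ℝ) :
    HasDerivAt (revenuePerturbation P a) (P (p - a) + p * deriv P (p - a)) p := by
  have h := (hP.contDiff.differentiable (by simp) (p - a)).hasDerivAt.comp_sub_const p a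
  simpa using! (hasDerivAt_id p).mul h

theorem deriv_revenuePerturbation (hP : IsSmallPerturbation P) (a : ℝ) :
    deriv (revenuePerturbation P a) = fun p => P (p - a) + p * deriv P (p - a) :=
  funext fun p => (hP.hasDerivAt_revenuePerturbation a p).deriv

theorem deriv_deriv_revenuePerturbation (hP : IsSmallPerturbation P) (a p : ℝ) :
    deriv (deriv (revenuePerturbation P a)) p
      = 2 * deriv P (p - a) + p * deriv (deriv P) (p - a) := by
  rw [hP.deriv_revenuePerturbation]
  have h1 := (hP.contDiff.differentiable (by simp) (p - a)).hasDerivAt.comp_sub_const p a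
  have h2 := (hP.contDiff_deriv.differentiable (by simp) (p - a)).hasDerivAt.comp_sub_const p a
  have h3 := h1.add ((hasDerivAt_id p).mul h2)
  rw [show (fun p => P (p - a) + p * deriv P (p - a))
    = (fun p => P (p - a)) + (id * fun p => deriv P (p - a)) from rfl, h3.deriv]
  simp only [id]
  ring

theorem contDiff_revenuePerturbation (hP : IsSmallPerturbation P) (a : ℝ) :
    ContDiff ℝ ∞ (revenuePerturbation P a) := by
  have h : ContDiff ℝ ∞ fun p => P (p - a) := hP.contDiff.comp (by fun_prop)
  exact contDiff_id.mul h

/-- No bound on `p` is needed: the factor `p` only multiplies `P''`, which vanishes unless `|p - a|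
≤ 1/16`, and then `|p| ≤ 1`. -/
theorem abs_deriv_deriv_revenuePerturbation_le (hP : IsSmallPerturbation P) {a : ℝ}
    (ha : a ∈ Icc (7 / 16 : ℝ) (9 / 16)) (p : ℝ) :
    |deriv (deriv (revenuePerturbation P a)) p| ≤ 3 / 2048 := by
  rw [hP.deriv_deriv_revenuePerturbation]
  have h1 := hP.abs_deriv_le (p - a)
  have h2 := hP.abs_deriv_deriv_le (p - a)
  have h3 : |p * deriv (deriv P) (p - a)| ≤ 1 / 2048 := by
    rcases le_or_gt |p - a| (1 / 16) with h | h
    · rw [abs_mul]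
      have hp : |p| ≤ 1 := by
        rw [abs_le] at h ⊢
        constructor <;> linarith [ha.1, ha.2, h.1, h.2]
      nlinarith [abs_nonneg p, abs_nonneg (deriv (deriv P) (p - a))]
    · rw [hP.deriv_deriv_eq_zero h]
      norm_num
  rw [abs_le] at h1 h3 ⊢
  constructor <;> linarith [h1.1, h1.2, h3.1, h3.2]

theorem abs_deriv_revenuePerturbation_sub_le (hP : IsSmallPerturbation P) {a : ℝ}
    (ha : a ∈ Icc (7 / 16 : ℝ) (9 / 16)) (p q : ℝ) :
    |deriv (revenuePerturbation P a) q - deriv (revenuePerturbation P a) p|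
      ≤ 3 / 2048 * |q - p| := by
  have hd := hP.contDiff_revenuePerturbation a
  rw [contDiff_infty_iff_deriv] at hd
  simpa using Convex.norm_image_sub_le_of_norm_deriv_le (𝕜 := ℝ) (s := univ)
    (f := deriv (revenuePerturbation P a)) (C := 3 / 2048)
    (fun z _ => hd.2.differentiable (by simp) z)
    (fun z _ => hP.abs_deriv_deriv_revenuePerturbation_le ha z) convex_univ (mem_univ p)
    (mem_univ q)

theorem abs_revenuePerturbation_taylor_le (hP : IsSmallPerturbation P) {a : ℝ}
    (ha : a ∈ Icc (7 / 16 : ℝ) (9 / 16)) (p q : ℝ) :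
    |revenuePerturbation P a q - revenuePerturbation P a p
      - deriv (revenuePerturbation P a) p * (q - p)| ≤ 3 / 2048 * (q - p) ^ 2 := by
  obtain ⟨ξ, h⟩ := exists_taylor_remainder (hP.contDiff_revenuePerturbation a) 1 p q
  have h2 := hP.abs_deriv_deriv_revenuePerturbation_le ha ξ
  simp only [Finset.sum_range_succ, Finset.sum_range_zero, iteratedDeriv_succ, iteratedDeriv_zero]
    at h
  norm_num at h
  rw [← sub_sub] at h
  rw [mul_comm (deriv _ _), h, abs_div, abs_mul, abs_of_nonneg (sq_nonneg (q - p)), abs_two]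
  nlinarith [sq_nonneg (q - p)]

/-- At every index the perturbed revenue has a maximizer close to the unperturbed one, it solves
the first order condition, and the revenue has quadratic growth around it. -/
theorem exists_maximizer (hP : IsSmallPerturbation P) {a : ℝ}
    (ha : a ∈ Icc (7 / 16 : ℝ) (9 / 16)) {r : ℝ → ℝ}
    (hr : ∀ p, r p = p * (rampTail (p - a) + P (p - a))) :
    ∃ q ∈ Icc (0 : ℝ) 1, |q - (1 / 4 + a / 2)| ≤ 1 / 32 ∧
      2 * (q - (1 / 4 + a / 2)) = deriv (revenuePerturbation P a) q ∧
      ∀ p ∈ Icc (0 : ℝ) 1,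
        1 / 40 / 2 * |p - q| ^ 2 ≤ r q - r p ∧ r q - r p ≤ 32 / 2 * |p - q| ^ 2 := by
  obtain ⟨ha1, ha2⟩ := ha
  have hcont : Continuous r := by
    rw [funext hr]
    have h1 := rampTail.contDiff.continuous
    have h2 := hP.contDiff.continuous
    fun_prop
  have hmid : ∀ p, |p - a| ≤ 3 / 8 →
      r p = 2 * (1 / 4 + a / 2) * p - p ^ 2 + revenuePerturbation P a p := fun p hp => by
    rw [hr, rampTail.eq_of_abs_le hp, revenuePerturbation]
    ring
  have hrange : ∀ z, 0 ≤ rampTail z + P z ∧ rampTail z + P z ≤ 1 := fun z => by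
    rw [← perturbedCDF_real_Ioi hP]
    have := isProbabilityMeasure_perturbedCDF hP
    exact ⟨measureReal_nonneg, measureReal_le_one⟩
  -- Outside the affine zone, a high price sells with probability at most the tail at `3/8`, which
  -- is `1/8`; a low price is itself below `9/16 - 3/8 = 3/16`.
  have hfar : ∀ p ∈ Icc (0 : ℝ) 1, 3 / 8 < |p - a| → r p ≤ 3 / 16 := fun p hp hpa => by
    rw [hr]
    rcases lt_abs.1 hpa with h | h
    · have h1 := hP.antitone (show (3 / 8 : ℝ) ≤ p - a from h.le)
      simp only at h1
      rw [rampTail.eq_of_abs_le (z := 3 / 8) (by norm_num), hP.eq_zero (3 / 8) (by norm_num)] at h1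
      nlinarith [hp.1, hp.2, (hrange (p - a)).1]
    · nlinarith [hp.1, hp.2, (hrange (p - a)).1, (hrange (p - a)).2]
  obtain ⟨q, hq, hmax⟩ := isCompact_Icc.exists_isMaxOn (s := Icc (0 : ℝ) 1)
    ⟨0, by simp⟩ hcont.continuousOn
  set p₀ : ℝ := 1 / 4 + a / 2 with hp₀
  have hp₀r : r p₀ = p₀ ^ 2 + p₀ * P (p₀ - a) := by
    rw [hmid p₀ (by rw [abs_le]; constructor <;> linarith), revenuePerturbation]
    ring
  have hP₀ := abs_le.1 (hP.abs_apply_le (p₀ - a))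
  have hq₀ : r p₀ ≤ r q := hmax ⟨by linarith, by linarith⟩
  have hqbig : 1 / 5 ≤ r q := by nlinarith
  have hqa : |q - a| ≤ 3 / 8 := by
    by_contra h
    have := hfar q hq (not_le.1 h)
    linarith
  have hqr := hmid q hqa
  have hPq := abs_le.1 (hP.abs_apply_le (q - a))
  -- Optimality of `q` against `p₀` bounds the square by two perturbation terms of size `1/2048`
  -- each, and `2/2048 = (1/32)²`.
  have hq2 : (q - p₀) ^ 2 ≤ (1 / 32) ^ 2 := by
    rw [revenuePerturbation] at hqr
    have e1 : q * P (q - a) ≤ 1 / 2048 :=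
      (mul_le_mul_of_nonneg_left hPq.2 hq.1).trans (by linarith [hq.2])
    have e2 : p₀ * (-(1 / 2048)) ≤ p₀ * P (p₀ - a) :=
      mul_le_mul_of_nonneg_left hP₀.1 (by linarith)
    have e3 : (q - p₀) ^ 2 = p₀ ^ 2 - (2 * p₀ * q - q ^ 2) := by ring
    linarith
  have hqd : |q - p₀| ≤ 1 / 32 := abs_le_of_sq_le_sq hq2 (by norm_num)
  have hqd' := abs_le.1 hqd
  have hqlt : |q - a| ≤ 1 / 16 := by rw [abs_le]; constructor <;> linarith
  have hfoc : 2 * (q - p₀) = deriv (revenuePerturbation P a) q := by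
    have hloc : IsLocalMax r q :=
      hmax.isLocalMax (Icc_mem_nhds (by linarith) (by linarith))
    have heq : r =ᶠ[nhds q] fun p => 2 * p₀ * p - p ^ 2 + revenuePerturbation P a p := by
      have : {p : ℝ | |p - a| < 3 / 8} ∈ nhds q :=
        (isOpen_lt (by fun_prop) continuous_const).mem_nhds (by
          change |q - a| < 3 / 8
          linarith)
      filter_upwards [this] with p hp
      exact hmid p (le_of_lt hp)
    have hN := hP.hasDerivAt_revenuePerturbation a q
    have hder : HasDerivAt (fun p => 2 * p₀ * p - p ^ 2 + revenuePerturbation P a p)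
        (2 * p₀ - 2 * q + (P (q - a) + q * deriv P (q - a))) q := by
      have h1 := ((hasDerivAt_id q).const_mul (2 * p₀)).sub ((hasDerivAt_id q).pow 2)
      simpa using! h1.add hN
    have h0 := hloc.hasDerivAt_eq_zero (hder.congr_of_eventuallyEq heq)
    rw [hN.deriv]
    linarith
  refine ⟨q, hq, hqd, hfoc, fun p hp => ?_⟩
  rw [sq_abs]
  -- In the affine zone the first-order condition makes the loss equal to `(p - q)²` minus a Taylor
  -- error of at most `3/2048 * (p - q)²`. In the far zone it is at least `1/5 - 3/16 = 1/80`, which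
  -- fixes the curvature constant `1/40`, and at most `1 ≤ 16 * (5/16)²`.
  rcases le_or_gt |p - a| (3 / 8) with h | h
  · have ht := abs_le.1 (hP.abs_revenuePerturbation_taylor_le ⟨ha1, ha2⟩ q p)
    rw [← hfoc] at ht
    rw [hqr, hmid p h]
    have hsq := sq_nonneg (p - q)
    constructor <;> linarith
  · have h1 := hfar p hp h
    have h2 : r q ≤ 1 := by
      rw [hr]
      nlinarith [hq.1, hq.2, (hrange (q - a)).1, (hrange (q - a)).2]
    have h3 : 0 ≤ r p := by
      rw [hr]
      exact mul_nonneg hp.1 (hrange _).1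
    have h4 : 5 / 16 ≤ |p - q| := by
      have := abs_sub_le p q a
      linarith
    have h5 : (p - q) ^ 2 ≤ 1 := by
      rw [sq_le_one_iff_abs_le_one, abs_le]
      constructor <;> linarith [hp.1, hp.2, hq.1, hq.2]
    have h6 : (5 / 16) ^ 2 ≤ (p - q) ^ 2 := by
      rw [← sq_abs (p - q)]
      gcongr
    constructor <;> linarith

end IsSmallPerturbation

/-! ### Perturbed instances satisfy the normalization -/

section Instance

variable {P : ℝ → ℝ} (hP : IsSmallPerturbation P)
  (x : ℕ → ℝ) (hx : ∀ t, x t ∈ Icc (7 / 16 : ℝ) (9 / 16))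

theorem perturbedInstance_isOraclePrice_of_growth {a q : ℝ} (hq : q ∈ Icc (0 : ℝ) 1)
    (hg : ∀ p ∈ Icc (0 : ℝ) 1, 1 / 40 / 2 * |p - q| ^ 2 ≤
      (perturbedInstance hP x hx).indexRevenue a q
        - (perturbedInstance hP x hx).indexRevenue a p) :
    (perturbedInstance hP x hx).IsOraclePrice a q ∧
      ∀ q', (perturbedInstance hP x hx).IsOraclePrice a q' → q' = q := by
  refine ⟨⟨hq, fun p hp => ?_⟩, fun q' hq' => ?_⟩
  · have := hg p hp
    have h2 : 0 ≤ |p - q| ^ 2 := by positivity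
    simp only [mem_ofPred_eq]
    linarith
  · have h1 := hg q' hq'.1
    have h2 : (perturbedInstance hP x hx).indexRevenue a q ≤
        (perturbedInstance hP x hx).indexRevenue a q' := hq'.2 hq
    have h3 : |q' - q| ^ 2 ≤ 0 := by linarith
    rw [sq_abs] at h3
    nlinarith [sq_eq_zero_iff.1 (le_antisymm h3 (sq_nonneg _))]

theorem perturbedInstance_stronglyUnimodal :
    (perturbedInstance hP x hx).StronglyUnimodal (1 / 40) 32 := by
  refine ⟨by norm_num, by norm_num, fun a ha => ?_⟩
  obtain ⟨q, hq, hqd, -, hg⟩ :=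
    hP.exists_maximizer ha (perturbedInstance_indexRevenue hP x hx a)
  obtain ⟨ho, hu⟩ := perturbedInstance_isOraclePrice_of_growth hP x hx hq fun p hp => (hg p hp).1
  refine ⟨⟨q, ho, hu⟩, fun q' hq' => ?_⟩
  obtain rfl := hu q' hq'
  have ha1 : (7 / 16 : ℝ) ≤ a := ha.1
  have ha2 : a ≤ (9 / 16 : ℝ) := ha.2
  rw [abs_le] at hqd
  exact ⟨⟨by linarith, by linarith⟩, hg⟩

theorem perturbedInstance_isLocalConcavityRadius :
    (perturbedInstance hP x hx).IsLocalConcavityRadius (1 / 40) (1 / 16) := by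
  refine ⟨by norm_num, fun a ha q' hq' => ?_⟩
  obtain ⟨q, hq, hqd, -, hg⟩ :=
    hP.exists_maximizer ha (perturbedInstance_indexRevenue hP x hx a)
  obtain ⟨-, hu⟩ := perturbedInstance_isOraclePrice_of_growth hP x hx hq fun p hp => (hg p hp).1
  obtain rfl := hu q' hq'
  have ha1 : (7 / 16 : ℝ) ≤ a := ha.1
  have ha2 : a ≤ (9 / 16 : ℝ) := ha.2
  rw [abs_le] at hqd
  refine ⟨fun p hp => ⟨by linarith [hp.1], by linarith [hp.2]⟩, fun p hp => ?_⟩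
  rw [abs_le] at hp
  -- A price within `1/16` of the maximizer has `|p - a| ≤ 1/8`, well inside the affine zone, so the
  -- second derivative is `-2` up to `3/2048`.
  have heq : (perturbedInstance hP x hx).indexRevenue a =ᶠ[nhds p]
      fun p => 2 * (1 / 4 + a / 2) * p - p ^ 2 + revenuePerturbation P a p := by
    have : {p : ℝ | |p - a| < 3 / 8} ∈ nhds p :=
      (isOpen_lt (by fun_prop) continuous_const).mem_nhds (by
        change |p - a| < 3 / 8
        rw [abs_lt]
        constructor <;> linarith)
    filter_upwards [this] with w hw
    rw [perturbedInstance_indexRevenue, rampTail.eq_of_abs_le (le_of_lt hw), revenuePerturbation]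
    ring
  have hd := hP.contDiff_revenuePerturbation a
  have hd' := hd
  rw [contDiff_infty_iff_deriv] at hd'
  have h1 : deriv (fun p => 2 * (1 / 4 + a / 2) * p - p ^ 2 + revenuePerturbation P a p)
      = fun p => 2 * (1 / 4 + a / 2) - 2 * p + deriv (revenuePerturbation P a) p := by
    funext w
    have h1 := ((hasDerivAt_id w).const_mul (2 * (1 / 4 + a / 2))).sub ((hasDerivAt_id w).pow 2)
    have h2 := h1.add (hd.differentiable (by simp) w).hasDerivAt
    simpa using! h2.deriv
  have h2 : HasDerivAt (fun p => 2 * (1 / 4 + a / 2) - 2 * p + deriv (revenuePerturbation P a) p)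
      (-2 + deriv (deriv (revenuePerturbation P a)) p) p := by
    have h1 := ((hasDerivAt_id p).const_mul 2).const_sub (2 * (1 / 4 + a / 2))
    simpa using! h1.add (hd'.2.differentiable (by simp) p).hasDerivAt
  rw [heq.iteratedDeriv_eq 2, iteratedDeriv_succ, iteratedDeriv_one, h1, h2.deriv]
  have := (abs_le.1 (hP.abs_deriv_deriv_revenuePerturbation_le ha p)).2
  linarith

theorem perturbedInstance_isLowerBoundNormalized {β Lg : ℝ}
    (hH : (perturbedInstance hP x hx).HolderTail β Lg) :
    (perturbedInstance hP x hx).IsLowerBoundNormalized β Lg (1 / 40) 32 (7 / 16) (9 / 16) where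
  linear := by
    refine ⟨one_pos, fun c hc => ?_, by simp, fun c hc => ?_, fun c _ => (mul_one c).symm⟩
    · have h1 : (7 / 16 : ℝ) ≤ c := hc.1
      have h2 : c ≤ (9 / 16 : ℝ) := hc.2
      rw [Metric.mem_closedBall, Real.dist_eq, abs_le]
      constructor <;> linarith
    · have h1 : (7 / 16 : ℝ) ≤ c := hc.1
      linarith
  context_subset := Icc_subset_Icc (by norm_num) (by norm_num)
  integrable_noise := integrable_perturbedCDF hP
  mean_noise := integral_perturbedCDF hP
  valuation_mem := fun c hc => by
    have h1 : (7 / 16 : ℝ) ≤ c := hc.1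
    have h2 : c ≤ (9 / 16 : ℝ) := hc.2
    filter_upwards [perturbedCDF_ae_mem hP] with ξ hξ
    change c + ξ ∈ _
    exact ⟨by linarith [hξ.1], by linarith [hξ.2]⟩
  umin_eq := rfl
  umax_eq := rfl
  interval_subset := Icc_subset_Icc (by norm_num [perturbedInstance])
    (by norm_num [perturbedInstance])
  bounded := ⟨by norm_num [perturbedInstance], fun c hc => hc⟩
  holder := hH
  unimodal := perturbedInstance_stronglyUnimodal hP x hx
  concavity := ⟨1 / 16, le_rfl, perturbedInstance_isLocalConcavityRadius hP x hx⟩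

/-- Hölder smoothness of the perturbed tail from derivative bounds on its two summands. -/
theorem perturbedInstance_holderTail {β M h : ℝ} (hβ : 2 ≤ β) (hM : 0 < M) (hh : 0 < h)
    (hh1 : h ≤ 1) (h₁ : ∀ k, 1 ≤ k → k ≤ ⌊β⌋₊ + 1 → ∀ z, |iteratedDeriv k rampTail z| ≤ M)
    (h₂ : ∀ k, k ≤ ⌊β⌋₊ + 1 → ∀ z, |iteratedDeriv k P z| ≤ M * h ^ (β - k)) :
    (perturbedInstance hP x hx).HolderTail β (4 * M) := by
  have hβ0 : (0 : ℝ) ≤ β := by linarith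
  have ht : (perturbedInstance hP x hx).tail = fun z => rampTail z + P z :=
    funext (perturbedInstance_tail hP x hx)
  have hsm : ContDiff ℝ ∞ fun z => rampTail z + P z := rampTail.contDiff.add hP.contDiff
  have hud : UniqueDiffOn ℝ (perturbedInstance hP x hx).gapInterval :=
    uniqueDiffOn_Icc (by norm_num [PricingInstance.halfLength, perturbedInstance])
  have hit : ∀ k, ∀ z ∈ (perturbedInstance hP x hx).gapInterval,
      iteratedDerivWithin k (perturbedInstance hP x hx).tail
        (perturbedInstance hP x hx).gapInterval z
      = iteratedDeriv k rampTail z + iteratedDeriv k P z := fun k z hz => by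
    rw [ht, iteratedDerivWithin_eq_iteratedDeriv hud
      (hsm.of_le (by exact_mod_cast le_top)).contDiffAt hz,
      iteratedDeriv_fun_add (rampTail.contDiff.of_le (by exact_mod_cast le_top)).contDiffAt
        (hP.contDiff.of_le (by exact_mod_cast le_top)).contDiffAt]
  refine ⟨by linarith, hβ, ?_, fun k hk1 hk z hz => ?_, fun z hz z' hz' => ?_⟩
  · rw [ht]
    exact (hsm.of_le (by exact_mod_cast le_top)).contDiffOn
  · rw [hit k z hz]
    have hkβ : (k : ℝ) ≤ β := le_trans (by exact_mod_cast hk) (Nat.floor_le hβ0)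
    have b1 := h₁ k hk1 (by omega) z
    have b2 := h₂ k (by omega) z
    have b3 : h ^ (β - k) ≤ 1 := Real.rpow_le_one hh.le hh1 (by linarith)
    have b4 := abs_add_le (iteratedDeriv k rampTail z) (iteratedDeriv k P z)
    nlinarith
  · simp only [hit _ z hz]
    simp only [ht, mul_add, Finset.sum_add_distrib]
    -- The base tail is treated at scale `1` and the perturbation at its own scale `h`; each
    -- contributes `2 * M`.
    have c1 := abs_taylor_remainder_le_rpow rampTail.contDiff (β := β) (h := 1) (by linarith)
      hM.le one_pos
      (by simpa using h₁ ⌊β⌋₊ (Nat.le_floor (by norm_num; linarith)) (by omega))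
      (by simpa using h₁ (⌊β⌋₊ + 1) (by omega) le_rfl) z z'
    have c2 := abs_taylor_remainder_le_rpow hP.contDiff (β := β) (h := h) (by linarith)
      hM.le hh (h₂ ⌊β⌋₊ (by omega))
      (by simpa using h₂ (⌊β⌋₊ + 1) le_rfl) z z'
    rw [add_sub_add_comm]
    refine (abs_add_le _ _).trans ?_
    linarith

/-- The per-round regret in a perturbed instance dominates the squared distance to a price solving
the first order condition. -/
theorem perturbedInstance_exists_regret_growth {a : ℝ} (ha : a ∈ Icc (7 / 16 : ℝ) (9 / 16)) :
    ∃ q, 2 * (q - (1 / 4 + a / 2)) = deriv (revenuePerturbation P a) q ∧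
      ∀ p ∈ Icc (0 : ℝ) 1, 1 / 80 * (p - q) ^ 2 ≤
        (perturbedInstance hP x hx).optRevenue a - (perturbedInstance hP x hx).revenue a p := by
  obtain ⟨q, hq, -, hfoc, hg⟩ :=
    hP.exists_maximizer ha (perturbedInstance_indexRevenue hP x hx a)
  obtain ⟨ho, -⟩ := perturbedInstance_isOraclePrice_of_growth hP x hx hq fun p hp => (hg p hp).1
  have hopt : (perturbedInstance hP x hx).optRevenue a
      = (perturbedInstance hP x hx).indexRevenue a q := by
    refine IsGreatest.csSup_eq ⟨⟨q, hq, rfl⟩, ?_⟩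
    rintro _ ⟨p, hp, rfl⟩
    exact ho.2 hp
  refine ⟨q, hfoc, fun p hp => ?_⟩
  have h := (hg p hp).1
  rw [sq_abs] at h
  rw [hopt]
  change _ ≤ _ - (perturbedInstance hP x hx).indexRevenue a p
  linarith

end Instance

/-! ### The wiggles -/

/-- A smooth cutoff equal to `1` on `[-1/2, 1/2]` and supported in `[-1, 1]`. -/
def unitBump : ContDiffBump (0 : ℝ) := ⟨1 / 2, 1, by norm_num, by norm_num⟩

/-- A smooth odd function supported in `[-1, 1]` with slope `1` at the origin. -/
def unitWiggle (z : ℝ) : ℝ := z * unitBump z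

namespace unitWiggle

theorem contDiff : ContDiff ℝ ∞ unitWiggle :=
  contDiff_id.mul unitBump.contDiff

theorem neg (z : ℝ) : unitWiggle (-z) = -unitWiggle z := by
  rw [unitWiggle, unitWiggle, unitBump.neg, neg_mul]

theorem tsupport_subset : tsupport unitWiggle ⊆ Icc (-1) 1 := by
  refine (tsupport_mul_subset_right (f := id) (g := unitBump)).trans ?_
  rw [unitBump.tsupport_eq, Real.closedBall_eq_Icc]
  norm_num [unitBump]

theorem hasCompactSupport : HasCompactSupport unitWiggle :=
  isCompact_Icc.of_isClosed_subset (isClosed_tsupport _) tsupport_subset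

theorem iteratedDeriv_eq_zero {z : ℝ} (hz : 1 < |z|) (n : ℕ) : iteratedDeriv n unitWiggle z = 0 :=
  iteratedDeriv_eq_zero_of_notMem_tsupport
    (fun h => not_le.2 hz (abs_le.2 (tsupport_subset h))) n

theorem abs_le_abs (z : ℝ) : |unitWiggle z| ≤ |z| := by
  rw [unitWiggle, abs_mul, abs_of_nonneg unitBump.nonneg]
  exact mul_le_of_le_one_right (abs_nonneg z) unitBump.le_one

theorem deriv_zero : deriv unitWiggle 0 = 1 := by
  have h : unitWiggle =ᶠ[nhds 0] id := by
    filter_upwards [unitBump.eventuallyEq_one] with z hz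
    rw [unitWiggle, hz]
    simp
  rw [h.deriv_eq, deriv_id]

end unitWiggle

/-- A finite sum with at most one nonzero term is bounded by any bound on its terms. -/
theorem Finset.abs_sum_le_of_pairwise_eq_zero {ι : Type*} (s : Finset ι) {F : ι → ℝ} {B : ℝ}
    (hB : 0 ≤ B) (h : ∀ i ∈ s, ∀ j ∈ s, F i ≠ 0 → F j ≠ 0 → i = j) (hF : ∀ i ∈ s, |F i| ≤ B) :
    |∑ i ∈ s, F i| ≤ B := by
  by_cases hz : ∃ i ∈ s, F i ≠ 0
  · obtain ⟨i, hi, hFi⟩ := hz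
    rw [Finset.sum_eq_single_of_mem i hi fun j hj hji => by
      by_contra hFj
      exact hji (h j hj i hi hFj hFi)]
    exact hF i hi
  · push Not at hz
    rw [Finset.sum_eq_zero hz, abs_zero]
    exact hB

/-- The sign `±1` attached to a Boolean. -/
def boolSign (b : Bool) : ℝ := if b then 1 else -1

theorem boolSign_not (b : Bool) : boolSign (!b) = -boolSign b := by
  cases b <;> simp [boolSign]

theorem abs_boolSign (b : Bool) : |boolSign b| = 1 := by
  cases b <;> simp [boolSign]

/-- The width of the wiggles when there are `K` of them. -/
def wiggleScale (K : ℕ) : ℝ := 1 / (64 * K)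

/-- The centre of the `k`-th wiggle. -/
def wiggleCenter (K : ℕ) (k : Fin K) : ℝ := -(1 / 32) + 4 * wiggleScale K * (k : ℕ)

/-- The `k`-th rescaled wiggle of Hölder exponent `β` and amplitude `ε`. -/
def wiggle (β ε : ℝ) (K : ℕ) (k : Fin K) (z : ℝ) : ℝ :=
  ε * wiggleScale K ^ β * unitWiggle ((wiggleScale K)⁻¹ * (z - wiggleCenter K k))

/-- The superposition of all wiggles with signs `w`. -/
def wiggleSum (β ε : ℝ) (K : ℕ) (w : Fin K → Bool) (z : ℝ) : ℝ :=
  ∑ k, boolSign (w k) * wiggle β ε K k z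

/-- The context at which the `k`-th wiggle sits at the optimal price of the unperturbed tail. -/
def wiggleContext (K : ℕ) (k : Fin K) : ℝ := 1 / 2 - 2 * wiggleCenter K k

section Wiggle

variable {β ε : ℝ} {K : ℕ}

theorem wiggleScale_pos (k : Fin K) : 0 < wiggleScale K := by
  have : 0 < K := k.pos
  unfold wiggleScale
  positivity

theorem wiggleScale_le (k : Fin K) : wiggleScale K ≤ 1 / 64 := by
  have : (1 : ℝ) ≤ K := by exact_mod_cast k.pos
  unfold wiggleScale
  exact one_div_le_one_div_of_le (by norm_num) (by linarith)

theorem abs_wiggleCenter_le (k : Fin K) : |wiggleCenter K k| ≤ 1 / 32 := by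
  have hk : ((k : ℕ) : ℝ) ≤ K := by exact_mod_cast k.is_lt.le
  have hs := wiggleScale_pos k
  have hK : (0 : ℝ) < K := by exact_mod_cast k.pos
  have h1 : wiggleScale K * (k : ℕ) ≤ 1 / 64 := by
    calc wiggleScale K * (k : ℕ) ≤ wiggleScale K * K := by gcongr
      _ = 1 / 64 := by
        unfold wiggleScale
        field_simp
  have h2 : 0 ≤ wiggleScale K * (k : ℕ) := by positivity
  rw [abs_le, wiggleCenter]
  constructor <;> linarith

theorem wiggleContext_mem (k : Fin K) : wiggleContext K k ∈ Icc (7 / 16 : ℝ) (9 / 16) := by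
  have := abs_le.1 (abs_wiggleCenter_le k)
  unfold wiggleContext
  constructor <;> linarith [this.1, this.2]

theorem wiggleCenter_separated {j k : Fin K} (hjk : j ≠ k) :
    4 * wiggleScale K ≤ |wiggleCenter K j - wiggleCenter K k| := by
  have h1 : (1 : ℝ) ≤ |((j : ℕ) : ℝ) - ((k : ℕ) : ℝ)| := by
    have : (1 : ℤ) ≤ |((j : ℕ) : ℤ) - ((k : ℕ) : ℤ)| :=
      Int.one_le_abs (sub_ne_zero.2 fun h => hjk (Fin.ext (by exact_mod_cast h)))
    exact_mod_cast this
  have hs := wiggleScale_pos k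
  rw [wiggleCenter, wiggleCenter, add_sub_add_left_eq_sub, ← mul_sub, abs_mul,
    abs_of_pos (by positivity)]
  nlinarith

theorem iteratedDeriv_wiggle (n : ℕ) (k : Fin K) (z : ℝ) :
    iteratedDeriv n (wiggle β ε K k) z = ε * wiggleScale K ^ (β - n) *
      iteratedDeriv n unitWiggle ((wiggleScale K)⁻¹ * (z - wiggleCenter K k)) := by
  have hs := wiggleScale_pos k
  have h1 : iteratedDeriv n (fun y => unitWiggle ((wiggleScale K)⁻¹ * (y - wiggleCenter K k))) z
      = (wiggleScale K)⁻¹ ^ n *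
        iteratedDeriv n unitWiggle ((wiggleScale K)⁻¹ * (z - wiggleCenter K k)) := by
    rw [iteratedDeriv_comp_sub_const n (fun y => unitWiggle ((wiggleScale K)⁻¹ * y)),
      iteratedDeriv_comp_const_mul (unitWiggle.contDiff.of_le (by exact_mod_cast le_top))]
  unfold wiggle
  rw [iteratedDeriv_const_mul_field, h1, Real.rpow_sub hs, Real.rpow_natCast, inv_pow]
  ring

theorem abs_sub_le_of_iteratedDeriv_wiggle_ne_zero {n : ℕ} {k : Fin K} {z : ℝ}
    (h : iteratedDeriv n (wiggle β ε K k) z ≠ 0) :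
    |z - wiggleCenter K k| ≤ wiggleScale K := by
  by_contra hlt
  have hs := wiggleScale_pos k
  refine h ?_
  rw [iteratedDeriv_wiggle, unitWiggle.iteratedDeriv_eq_zero, mul_zero]
  rw [abs_mul, abs_of_pos (inv_pos.2 hs), inv_mul_eq_div, lt_div_iff₀ hs]
  linarith

theorem eq_of_abs_sub_wiggleCenter_le {j k : Fin K} {z : ℝ}
    (hj : |z - wiggleCenter K j| ≤ wiggleScale K) (hk : |z - wiggleCenter K k| ≤ wiggleScale K) :
    j = k := by
  by_contra hjk
  have h1 := wiggleCenter_separated hjk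
  have h2 := abs_sub_le (wiggleCenter K j) z (wiggleCenter K k)
  rw [abs_sub_comm (wiggleCenter K j) z] at h2
  have hs := wiggleScale_pos k
  linarith

theorem contDiff_wiggle (k : Fin K) : ContDiff ℝ ∞ (wiggle β ε K k) := by
  have h : ContDiff ℝ ∞ fun z => unitWiggle ((wiggleScale K)⁻¹ * (z - wiggleCenter K k)) :=
    unitWiggle.contDiff.comp (by fun_prop)
  exact contDiff_const.mul h

theorem contDiff_wiggleSum (w : Fin K → Bool) : ContDiff ℝ ∞ (wiggleSum β ε K w) :=
  ContDiff.sum fun k _ => contDiff_const.mul (contDiff_wiggle k)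

theorem iteratedDeriv_wiggleSum (w : Fin K → Bool) (n : ℕ) (z : ℝ) :
    iteratedDeriv n (wiggleSum β ε K w) z
      = ∑ k, boolSign (w k) * iteratedDeriv n (wiggle β ε K k) z := by
  unfold wiggleSum
  rw [iteratedDeriv_fun_sum fun k _ =>
    ((contDiff_const.mul (contDiff_wiggle k)).of_le (by exact_mod_cast le_top)).contDiffAt]
  simp only [iteratedDeriv_const_mul_field]

/-- The supports are disjoint, so at each point at most one wiggle contributes and no factor `K`
appears. -/
theorem abs_iteratedDeriv_wiggleSum_le (hε : 0 ≤ ε) (w : Fin K → Bool) {n : ℕ} {C : ℝ}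
    (hC : ∀ z, |iteratedDeriv n unitWiggle z| ≤ C) (z : ℝ) :
    |iteratedDeriv n (wiggleSum β ε K w) z| ≤ ε * C * wiggleScale K ^ (β - n) := by
  have hC0 : 0 ≤ C := (abs_nonneg _).trans (hC 0)
  have hs : 0 ≤ wiggleScale K := by
    unfold wiggleScale
    positivity
  rw [iteratedDeriv_wiggleSum]
  refine Finset.abs_sum_le_of_pairwise_eq_zero _ (by positivity) (fun i _ j _ hi hj => ?_)
    fun i _ => ?_
  · exact eq_of_abs_sub_wiggleCenter_le
      (abs_sub_le_of_iteratedDeriv_wiggle_ne_zero (right_ne_zero_of_mul hi))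
      (abs_sub_le_of_iteratedDeriv_wiggle_ne_zero (right_ne_zero_of_mul hj))
  · rw [abs_mul, abs_boolSign, one_mul, iteratedDeriv_wiggle, abs_mul, abs_mul,
      abs_of_nonneg hε, abs_of_nonneg (by positivity), mul_right_comm]
    gcongr
    exact hC _

theorem wiggle_eq_zero {k : Fin K} {z : ℝ} (h : wiggleScale K < |z - wiggleCenter K k|) :
    wiggle β ε K k z = 0 := by
  by_contra hne
  exact not_le.2 h (abs_sub_le_of_iteratedDeriv_wiggle_ne_zero (n := 0) (by simpa using hne))

theorem wiggleSum_eq_zero (w : Fin K → Bool) {z : ℝ} (hz : 1 / 16 ≤ |z|) :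
    wiggleSum β ε K w z = 0 :=
  Finset.sum_eq_zero fun k _ => by
    have h1 := abs_wiggleCenter_le k
    have h2 := wiggleScale_le k
    have h3 := abs_sub_abs_le_abs_sub z (wiggleCenter K k)
    rw [wiggle_eq_zero (by linarith), mul_zero]

/-- Each wiggle is odd about its centre. -/
theorem integral_wiggle (k : Fin K) : ∫ z, wiggle β ε K k z = 0 := by
  have h := integral_sub_left_eq_self (wiggle β ε K k) volume (2 * wiggleCenter K k)
  have h1 : ∀ z, wiggle β ε K k (2 * wiggleCenter K k - z) = -wiggle β ε K k z := fun z => by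
    rw [wiggle, wiggle, ← mul_neg, ← unitWiggle.neg]
    congr 2
    ring
  simp only [h1, integral_neg] at h
  linarith

theorem integrable_wiggle (k : Fin K) : Integrable (wiggle β ε K k) := by
  refine (contDiff_wiggle k).continuous.integrable_of_hasCompactSupport
    (HasCompactSupport.of_support_subset_isCompact (isCompact_closedBall (wiggleCenter K k)
      (wiggleScale K)) fun z hz => ?_)
  rw [Metric.mem_closedBall, Real.dist_eq]
  by_contra h
  exact hz (wiggle_eq_zero (not_le.1 h))

theorem integral_wiggleSum (w : Fin K → Bool) : ∫ z, wiggleSum β ε K w z = 0 := by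
  unfold wiggleSum
  rw [integral_finsetSum _ fun k _ => (integrable_wiggle k).const_mul _]
  simp [integral_const_mul, integral_wiggle]

/-- `β ≥ 2` makes `wiggleScale K ^ (β - n) ≤ 1` for `n ≤ 2`, so smallness depends on `ε` alone and
not on `K`. -/
theorem isSmallPerturbation_wiggleSum (hβ : 2 ≤ β) (hε : 0 ≤ ε) {C : ℝ}
    (hC : ∀ n ≤ 2, ∀ z, |iteratedDeriv n unitWiggle z| ≤ C) (hεC : ε * C ≤ 1 / 2048)
    (w : Fin K → Bool) : IsSmallPerturbation (wiggleSum β ε K w) := by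
  have hC0 : 0 ≤ C := (abs_nonneg _).trans (hC 0 (by norm_num) 0)
  have key : ∀ n ≤ 2, ∀ z, |iteratedDeriv n (wiggleSum β ε K w) z| ≤ 1 / 2048 := by
    intro n hn z
    refine (abs_iteratedDeriv_wiggleSum_le hε w (hC n hn) z).trans ?_
    have hs : 0 ≤ wiggleScale K := by
      unfold wiggleScale
      positivity
    have hs1 : wiggleScale K ≤ 1 := by
      rcases Nat.eq_zero_or_pos K with rfl | hK
      · simp [wiggleScale]
      · linarith [wiggleScale_le (⟨0, hK⟩ : Fin K)]
    have hn' : (n : ℝ) ≤ 2 := by exact_mod_cast hn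
    have := Real.rpow_le_one hs hs1 (z := β - n) (by linarith)
    exact (mul_le_of_le_one_right (by positivity) this).trans hεC
  refine ⟨contDiff_wiggleSum w, ?_, ?_, ?_, fun z hz => wiggleSum_eq_zero w hz,
    integral_wiggleSum w⟩
  · simpa using key 0 (by norm_num)
  · simpa using key 1 (by norm_num)
  · simpa [iteratedDeriv_succ] using key 2 le_rfl

/-- The unperturbed optimal price at the `j`-th context probes exactly this point, so posting it
reveals nothing about any sign. -/
theorem wiggleSum_center (w : Fin K → Bool) (j : Fin K) :
    wiggleSum β ε K w (wiggleCenter K j) = 0 :=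
  Finset.sum_eq_zero fun k _ => by
    rcases eq_or_ne j k with rfl | hjk
    · simp [wiggle, unitWiggle]
    · have := wiggleCenter_separated hjk
      have hs := wiggleScale_pos k
      rw [wiggle_eq_zero (by linarith), mul_zero]

theorem deriv_wiggleSum_center (w : Fin K → Bool) (j : Fin K) :
    deriv (wiggleSum β ε K w) (wiggleCenter K j)
      = boolSign (w j) * (ε * wiggleScale K ^ (β - 1)) := by
  rw [← iteratedDeriv_one, iteratedDeriv_wiggleSum, Finset.sum_eq_single j]
  · rw [iteratedDeriv_wiggle, sub_self, mul_zero, iteratedDeriv_one, unitWiggle.deriv_zero]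
    simp
  · intro k _ hk
    by_contra h
    have h1 := abs_sub_le_of_iteratedDeriv_wiggle_ne_zero (right_ne_zero_of_mul h)
    have h2 := wiggleCenter_separated hk.symm
    have hs := wiggleScale_pos k
    linarith
  · simp

/-- The signal is at most `d` times the distance to the centre of the bump being probed. Where the
`k`-th wiggle is nonzero, its own centre is the nearest one, so this distance may be replaced by
that to any other centre `j`. Hence probing another bump from the `j`-th context is no cheaper. -/
theorem wiggle_sq_le (hε : 0 ≤ ε) (j k : Fin K) (z : ℝ) :
    wiggle β ε K k z ^ 2 ≤ (ε * wiggleScale K ^ (β - 1)) ^ 2 * (z - wiggleCenter K j) ^ 2 := by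
  have hs := wiggleScale_pos k
  rcases le_or_gt |z - wiggleCenter K k| (wiggleScale K) with h | h
  · rw [← mul_pow]
    refine sq_le_sq.2 ?_
    have h1 : |wiggle β ε K k z| ≤ ε * wiggleScale K ^ (β - 1) * |z - wiggleCenter K k| := by
      have h2 := unitWiggle.abs_le_abs ((wiggleScale K)⁻¹ * (z - wiggleCenter K k))
      rw [abs_mul, abs_of_pos (inv_pos.2 hs)] at h2
      rw [wiggle, abs_mul, abs_of_nonneg (by positivity), Real.rpow_sub hs, Real.rpow_one]
      calc ε * wiggleScale K ^ β * |unitWiggle ((wiggleScale K)⁻¹ * (z - wiggleCenter K k))|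
          ≤ ε * wiggleScale K ^ β * ((wiggleScale K)⁻¹ * |z - wiggleCenter K k|) := by gcongr
        _ = _ := by ring
    have h3 : |z - wiggleCenter K k| ≤ |z - wiggleCenter K j| := by
      rcases eq_or_ne j k with rfl | hjk
      · exact le_rfl
      · have h4 := wiggleCenter_separated hjk
        have h5 := abs_sub_le (wiggleCenter K j) z (wiggleCenter K k)
        rw [abs_sub_comm (wiggleCenter K j) z] at h5
        linarith
    rw [abs_mul, abs_of_nonneg (by positivity : 0 ≤ ε * wiggleScale K ^ (β - 1))]
    refine h1.trans ?_
    gcongr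
  · rw [wiggle_eq_zero h, zero_pow two_ne_zero]
    positivity

theorem sum_wiggle_sq_le (hε : 0 ≤ ε) (j : Fin K) (z : ℝ) :
    ∑ k, wiggle β ε K k z ^ 2
      ≤ (ε * wiggleScale K ^ (β - 1)) ^ 2 * (z - wiggleCenter K j) ^ 2 := by
  refine (le_abs_self _).trans (Finset.abs_sum_le_of_pairwise_eq_zero _ (by positivity)
    (fun i _ k _ hi hk => ?_) fun k _ => ?_)
  · refine eq_of_abs_sub_wiggleCenter_le (z := z) (le_of_not_gt fun h => hi ?_)
      (le_of_not_gt fun h => hk ?_)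
    · rw [wiggle_eq_zero h, zero_pow two_ne_zero]
    · rw [wiggle_eq_zero h, zero_pow two_ne_zero]
  · rw [abs_of_nonneg (sq_nonneg _)]
    exact wiggle_sq_le hε j k z

/-- The sign of the `j`-th wiggle determines on which side of the unperturbed optimal price
the optimal price at the `j`-th context lies. -/
theorem firstOrder_wiggleSum {w : Fin K → Bool} (hP : IsSmallPerturbation (wiggleSum β ε K w))
    (hε : 0 ≤ ε) (j : Fin K) {q : ℝ}
    (hq : 2 * (q - (1 / 4 + wiggleContext K j / 2))
      = deriv (revenuePerturbation (wiggleSum β ε K w) (wiggleContext K j)) q) :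
    |q - (1 / 2 - wiggleCenter K j)| ≤ ε * wiggleScale K ^ (β - 1) ∧
      ε * wiggleScale K ^ (β - 1) / 8
        ≤ boolSign (w j) * (q - (1 / 2 - wiggleCenter K j)) := by
  have hd : 0 ≤ ε * wiggleScale K ^ (β - 1) := by
    have hs := wiggleScale_pos j
    positivity
  have h0 : deriv (revenuePerturbation (wiggleSum β ε K w) (wiggleContext K j))
      (1 / 2 - wiggleCenter K j)
      = (1 / 2 - wiggleCenter K j) * (boolSign (w j) * (ε * wiggleScale K ^ (β - 1))) := by
    rw [hP.deriv_revenuePerturbation]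
    have e : 1 / 2 - wiggleCenter K j - wiggleContext K j = wiggleCenter K j := by
      rw [wiggleContext]
      ring
    simp only [e, wiggleSum_center, deriv_wiggleSum_center, zero_add]
  -- Twice the displacement of `q` equals `±(1/2 - c) * d` up to `3/2048` of the displacement. Since
  -- `1/2 - c` lies in `[15/32, 17/32]`, the displacement has the sign of the wiggle and size
  -- between `d/8` and `d`.
  have h1 := hP.abs_deriv_revenuePerturbation_sub_le (wiggleContext_mem j)
    (1 / 2 - wiggleCenter K j) q
  rw [← hq, h0, show 1 / 4 + wiggleContext K j / 2 = 1 / 2 - wiggleCenter K j by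
    rw [wiggleContext]; ring] at h1
  have hc := abs_le.1 (abs_wiggleCenter_le j)
  generalize ε * wiggleScale K ^ (β - 1) = d at *
  generalize wiggleCenter K j = c at *
  have hc1 : (15 / 32) * d ≤ (1 / 2 - c) * d := by
    gcongr
    linarith
  have hc2 : (1 / 2 - c) * d ≤ (17 / 32) * d := by
    gcongr
    linarith
  have hs : boolSign (w j) = 1 ∨ boolSign (w j) = -1 := by
    cases w j <;> simp [boolSign]
  have h2 := abs_le.1 h1
  rcases hs with hs | hs <;> rw [hs] at h2 ⊢ <;>
    rcases abs_cases (q - (1 / 2 - c)) with ⟨ha, hb⟩ | ⟨ha, hb⟩ <;> rw [ha] at h2 ⊢ <;>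
    constructor <;> linarith

end Wiggle

/-! ### Testing between adaptive coin-flip laws -/

/-- The law of the first `t` bits of an adaptive sequence of coin flips, where `q t y` is the
probability of success at time `t` after the history `y`. -/
def treeMass (q : (t : ℕ) → (Fin t → Bool) → ℝ) : (t : ℕ) → (Fin t → Bool) → ℝ
  | 0, _ => 1
  | t + 1, y => treeMass q t (fun i => y i.castSucc) *
      (if y (Fin.last t) then q t (fun i => y i.castSucc) else 1 - q t (fun i => y i.castSucc))

/-- The expectation of a function of the first `t` bits of an adaptive sequence of coin flips. -/
def treeExp (q : (t : ℕ) → (Fin t → Bool) → ℝ) (t : ℕ) (f : (Fin t → Bool) → ℝ) : ℝ :=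
  ∑ y, treeMass q t y * f y

theorem sum_fin_succ_bool (t : ℕ) (f : (Fin (t + 1) → Bool) → ℝ) :
    ∑ y, f y = ∑ y : Fin t → Bool, (f (Fin.snoc (α := fun _ => Bool) y true)
      + f (Fin.snoc (α := fun _ => Bool) y false)) := by
  rw [← (Fin.snocEquiv (fun _ : Fin (t + 1) => Bool)).sum_comp, Fintype.sum_prod_type,
    Fintype.sum_bool, ← Finset.sum_add_distrib]
  rfl

theorem treeMass_snoc (q : (t : ℕ) → (Fin t → Bool) → ℝ) (t : ℕ) (y : Fin t → Bool) (b : Bool) :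
    treeMass q (t + 1) (Fin.snoc (α := fun _ => Bool) y b)
      = treeMass q t y * (if b then q t y else 1 - q t y) := by
  simp [treeMass]

/-- Adaptive coin-flip probabilities. -/
def IsTreeKernel (q : (t : ℕ) → (Fin t → Bool) → ℝ) : Prop := ∀ t y, q t y ∈ Icc (0 : ℝ) 1

section Tree

variable {q q' : (t : ℕ) → (Fin t → Bool) → ℝ}

theorem treeMass_nonneg (hq : IsTreeKernel q) (t : ℕ) (y : Fin t → Bool) :
    0 ≤ treeMass q t y := by
  induction t with
  | zero => exact zero_le_one
  | succ t ih =>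
    refine mul_nonneg (ih _) ?_
    split_ifs
    · exact (hq t _).1
    · exact sub_nonneg.2 (hq t _).2

theorem sum_treeMass (q : (t : ℕ) → (Fin t → Bool) → ℝ) (t : ℕ) : ∑ y, treeMass q t y = 1 := by
  induction t with
  | zero => simp [treeMass]
  | succ t ih =>
    rw [sum_fin_succ_bool, ← ih]
    refine Finset.sum_congr rfl fun y _ => ?_
    rw [treeMass_snoc, treeMass_snoc]
    simp
    ring

theorem treeExp_mono (hq : IsTreeKernel q) {t : ℕ} {f g : (Fin t → Bool) → ℝ}
    (h : ∀ y, f y ≤ g y) : treeExp q t f ≤ treeExp q t g :=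
  Finset.sum_le_sum fun y _ => mul_le_mul_of_nonneg_left (h y) (treeMass_nonneg hq t y)

theorem treeExp_const_mul (q : (t : ℕ) → (Fin t → Bool) → ℝ) (t : ℕ) (c : ℝ)
    (f : (Fin t → Bool) → ℝ) : treeExp q t (fun y => c * f y) = c * treeExp q t f := by
  rw [treeExp, treeExp, Finset.mul_sum]
  exact Finset.sum_congr rfl fun y _ => by ring

theorem treeExp_sub_const (q : (t : ℕ) → (Fin t → Bool) → ℝ) (t : ℕ) (c : ℝ)
    (f : (Fin t → Bool) → ℝ) : treeExp q t (fun y => f y - c) = treeExp q t f - c := by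
  simp only [treeExp, mul_sub, Finset.sum_sub_distrib, ← Finset.sum_mul, sum_treeMass, one_mul]

theorem treeExp_sum (q : (t : ℕ) → (Fin t → Bool) → ℝ) (t : ℕ) {ι : Type*} (s : Finset ι)
    (f : ι → (Fin t → Bool) → ℝ) :
    treeExp q t (fun y => ∑ i ∈ s, f i y) = ∑ i ∈ s, treeExp q t (f i) := by
  simp only [treeExp, Finset.mul_sum]
  exact Finset.sum_comm

/-- The Bhattacharyya coefficient of two Bernoulli laws is close to one. -/
theorem one_sub_le_bernoulli_affinity {p r : ℝ} (hp : p ∈ Icc (1 / 4 : ℝ) (3 / 4))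
    (hr : r ∈ Icc (0 : ℝ) 1) :
    1 - 4 * (p - r) ^ 2 ≤ √(p * r) + √((1 - p) * (1 - r)) := by
  -- Use `√(ab) = (a + b)/2 - (√a - √b)²/2` and `(√a - √b)² (√a + √b)² = (a - b)²`. The second
  -- factor is at least `1/4` as soon as one of the two numbers is, so `r` may be anywhere in `[0,
  -- 1]`.
  have key : ∀ a b : ℝ, 1 / 4 ≤ a → 0 ≤ b → (a + b) / 2 - 2 * (a - b) ^ 2 ≤ √(a * b) := by
    intro a b ha hb
    have h1 := Real.sq_sqrt (show 0 ≤ a by linarith)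
    have h2 := Real.sq_sqrt hb
    have h3 := Real.sqrt_nonneg a
    have h4 := Real.sqrt_nonneg b
    rw [Real.sqrt_mul (by linarith)]
    generalize √a = x at *
    generalize √b = y at *
    subst h1 h2
    have h5 : 1 ≤ 4 * (x + y) ^ 2 := by nlinarith [mul_nonneg h3 h4]
    have h6 := mul_le_mul_of_nonneg_left h5 (sq_nonneg (x - y))
    have h7 : (x ^ 2 - y ^ 2) ^ 2 = (x - y) ^ 2 * (x + y) ^ 2 := by ring
    rw [h7]
    linarith [show (x ^ 2 + y ^ 2) / 2 = x * y + (x - y) ^ 2 / 2 by ring]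
  have h1 := key p r hp.1 hr.1
  have h2 := key (1 - p) (1 - r) (by linarith [hp.2]) (by linarith [hr.2])
  have h3 : (1 - p - (1 - r)) ^ 2 = (p - r) ^ 2 := by ring
  rw [h3] at h2
  linarith

theorem Real.sqrt_mul_le_half_add {a b : ℝ} (ha : 0 ≤ a) (hb : 0 ≤ b) : √(a * b) ≤ (a + b) / 2 := by
  refine Real.sqrt_le_iff.2 ⟨by positivity, ?_⟩
  nlinarith [sq_nonneg (a - b)]

/-- The Bhattacharyya affinity of two adaptive coin-flip laws is bounded below by the expected
cumulative squared differences of the success probabilities. -/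
theorem one_sub_le_tree_affinity (hq : IsTreeKernel q) (hq' : IsTreeKernel q')
    (hmid : ∀ t y, q t y ≠ q' t y → q t y ∈ Icc (1 / 4 : ℝ) (3 / 4)) (t : ℕ) :
    1 - 2 * ∑ s ∈ Finset.range t, (treeExp q s (fun y => (q s y - q' s y) ^ 2)
        + treeExp q' s (fun y => (q s y - q' s y) ^ 2))
      ≤ ∑ y, √(treeMass q t y * treeMass q' t y) := by
  induction t with
  | zero => simp [treeMass]
  | succ t ih =>
    rw [Finset.sum_range_succ, sum_fin_succ_bool]
    have key : ∑ y, √(treeMass q t y * treeMass q' t y)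
        - 2 * (treeExp q t (fun y => (q t y - q' t y) ^ 2)
          + treeExp q' t (fun y => (q t y - q' t y) ^ 2))
        ≤ ∑ y : Fin t → Bool,
          (√(treeMass q (t + 1) (Fin.snoc (α := fun _ => Bool) y true)
              * treeMass q' (t + 1) (Fin.snoc (α := fun _ => Bool) y true))
          + √(treeMass q (t + 1) (Fin.snoc (α := fun _ => Bool) y false)
              * treeMass q' (t + 1) (Fin.snoc (α := fun _ => Bool) y false))) := by
      rw [treeExp, treeExp, ← Finset.sum_add_distrib, Finset.mul_sum, ← Finset.sum_sub_distrib]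
      refine Finset.sum_le_sum fun y _ => ?_
      simp only [treeMass_snoc, if_true, Bool.false_eq_true, if_false]
      have m := treeMass_nonneg hq t y
      have m' := treeMass_nonneg hq' t y
      rw [mul_mul_mul_comm _ (q t y), mul_mul_mul_comm _ (1 - q t y), Real.sqrt_mul (mul_nonneg m m'),
        Real.sqrt_mul (mul_nonneg m m'), ← mul_add]
      -- Where the two kernels agree the affinity is exactly `1`; the restriction to `[1/4, 3/4]`
      -- matters only where they differ.
      have haff : 1 - 4 * (q t y - q' t y) ^ 2
          ≤ √(q t y * q' t y) + √((1 - q t y) * (1 - q' t y)) := by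
        by_cases h : q t y = q' t y
        · rw [← h, Real.sqrt_mul_self (hq t y).1, Real.sqrt_mul_self (sub_nonneg.2 (hq t y).2)]
          simp
        · exact one_sub_le_bernoulli_affinity (hmid t y h) (hq' t y)
      have h1 := mul_le_mul_of_nonneg_left haff (Real.sqrt_nonneg (treeMass q t y * treeMass q' t y))
      have h2 := mul_le_mul_of_nonneg_right (Real.sqrt_mul_le_half_add m m')
        (sq_nonneg (q t y - q' t y))
      linarith
    linarith

/-- Le Cam's bound on the error of a test between two adaptive coin-flip laws. -/
theorem tree_test_error (hq : IsTreeKernel q) (hq' : IsTreeKernel q')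
    (hmid : ∀ t y, q t y ≠ q' t y → q t y ∈ Icc (1 / 4 : ℝ) (3 / 4)) (t : ℕ)
    {f f' : (Fin t → Bool) → ℝ} (hf : ∀ y, 0 ≤ f y) (hf' : ∀ y, 0 ≤ f' y)
    (hff' : ∀ y, 1 ≤ f y + f' y) :
    1 / 2 - 2 * ∑ s ∈ Finset.range t, (treeExp q s (fun y => (q s y - q' s y) ^ 2)
        + treeExp q' s (fun y => (q s y - q' s y) ^ 2)) ≤ treeExp q t f + treeExp q' t f' := by
  have h := one_sub_le_tree_affinity hq hq' hmid t
  have h2 : ∑ y, √(treeMass q t y * treeMass q' t y)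
      - (∑ y, treeMass q t y + ∑ y, treeMass q' t y) / 4 ≤ treeExp q t f + treeExp q' t f' := by
    rw [treeExp, treeExp, ← Finset.sum_add_distrib, ← Finset.sum_add_distrib, Finset.sum_div,
      ← Finset.sum_sub_distrib]
    refine Finset.sum_le_sum fun y _ => ?_
    have m := treeMass_nonneg hq t y
    have m' := treeMass_nonneg hq' t y
    -- Weighted AM-GM, applied both ways, bounds `√(a * c) - (a + c) / 4` by both masses. Summed
    -- over histories it gives an error bound linear in the affinity, of size affinity minus `1/2`.
    have b : ∀ a c : ℝ, 0 ≤ a → 0 ≤ c → √(a * c) ≤ a + c / 4 := fun a c ha hc => by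
      have := Real.sqrt_mul_le_half_add (a := 2 * a) (b := c / 2) (by positivity) (by positivity)
      rw [show 2 * a * (c / 2) = a * c by ring] at this
      linarith
    have b1 := b _ _ m m'
    have b2 := b _ _ m' m
    rw [mul_comm] at b2
    generalize √(treeMass q t y * treeMass q' t y) = r at *
    generalize treeMass q t y = a at *
    generalize treeMass q' t y = c at *
    have hc1 : r - (a + c) / 4 ≤ a := by linarith
    have hc2 : r - (a + c) / 4 ≤ c := by linarith
    have h1 := hf y
    have h2 := hf' y
    have h3 := hff' y
    rcases le_total (r - (a + c) / 4) 0 with h0 | h0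
    · exact h0.trans (by positivity)
    · nlinarith [mul_le_mul_of_nonneg_right hc1 h1, mul_le_mul_of_nonneg_right hc2 h2,
        mul_le_mul_of_nonneg_left h3 h0]
  rw [sum_treeMass, sum_treeMass] at h2
  linarith

end Tree

/-! ### From pricing policies to coin flips -/

namespace PricingInstance

variable {X : Type v} [MeasurableSpace X] {pmax : ℝ}

/-- Success probabilities of the purchase indicators when the policy `π` with seed `s` faces the
contexts `x`. -/
def saleKernel (I : PricingInstance X pmax) (π : PricingPolicy.{u, v} X pmax) (x : ℕ → X)
    (s : π.Seed) (t : ℕ) (y : Fin t → Bool) : ℝ :=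
  I.tail (π.price t s (fun i => x i) y - I.utility (x t))

theorem isTreeKernel_saleKernel (I : PricingInstance X pmax) (π : PricingPolicy.{u, v} X pmax)
    (x : ℕ → X) (s : π.Seed) : IsTreeKernel (I.saleKernel π x s) := fun t y => by
  rw [saleKernel, tail]
  exact ⟨sub_nonneg.2 (cdf_le_one _ _), sub_le_self _ (cdf_nonneg _ _)⟩

/-- Once the history is prescribed, every price is determined by it, so the event splits into one
condition on each noise separately. This is what makes its probability a product. -/
theorem outcomes_eq_iff (I : PricingInstance X pmax) (π : PricingPolicy.{u, v} X pmax)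
    (x : ℕ → X) (s : π.Seed) (ξ : ℕ → ℝ) (Y : ℕ → Bool) (t : ℕ) :
    I.outcomes π s x ξ t = (fun i : Fin t => Y i) ↔ ∀ i < t,
      decide (π.price i s (fun j => x j) (fun j => Y j) ≤ I.utility (x i) + ξ i) = Y i := by
  induction t with
  | zero => simp [funext_iff]
  | succ t ih =>
    have h1 : I.outcomes π s x ξ (t + 1) = (fun i : Fin (t + 1) => Y i) ↔
        I.outcomes π s x ξ t = (fun i : Fin t => Y i) ∧
        decide (π.price t s (fun i => x i) (I.outcomes π s x ξ t) ≤ I.utility (x t) + ξ t)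
          = Y t := by
      rw [outcomes, funext_iff, Fin.forall_fin_succ', funext_iff]
      simp
    rw [h1, ih]
    constructor
    · rintro ⟨ha, hb⟩ i hi
      rcases Nat.lt_succ_iff_lt_or_eq.1 hi with hi | rfl
      · exact ha i hi
      · rwa [ih.2 ha] at hb
    · intro h
      have ha := fun i (hi : i < t) => h i (by omega)
      refine ⟨ha, ?_⟩
      rw [ih.2 ha]
      exact h t (by omega)

theorem measurable_outcomes (I : PricingInstance X pmax) (π : PricingPolicy.{u, v} X pmax)
    (x : ℕ → X) (t : ℕ) :
    Measurable fun z : (ℕ → ℝ) × π.Seed => I.outcomes π z.2 x z.1 t := by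
  induction t with
  | zero => exact measurable_of_subsingleton_codomain _
  | succ t ih =>
    have hp : Measurable fun z : (ℕ → ℝ) × π.Seed =>
        π.price t z.2 (fun i => x i) (I.outcomes π z.2 x z.1 t) :=
      (π.measurable_price t).comp (measurable_snd.prodMk (measurable_const.prodMk ih))
    have hv : Measurable fun z : (ℕ → ℝ) × π.Seed => I.utility (x t) + z.1 t := by fun_prop
    refine measurable_pi_lambda _ fun i => ?_
    induction i using Fin.lastCases with
    | cast i =>
      simp only [outcomes, Fin.snoc_castSucc]
      exact (measurable_pi_apply i).comp ih
    | last =>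
      simp only [outcomes, Fin.snoc_last]
      have : (fun z : (ℕ → ℝ) × π.Seed => decide (π.price t z.2 (fun i => x i)
          (I.outcomes π z.2 x z.1 t) ≤ I.utility (x t) + z.1 t))
          = fun z => if π.price t z.2 (fun i => x i) (I.outcomes π z.2 x z.1 t)
            ≤ I.utility (x t) + z.1 t then true else false := by
        funext z
        simp
      rw [this]
      exact Measurable.ite (measurableSet_le hp hv) measurable_const measurable_const

theorem measurable_postedPrice (I : PricingInstance X pmax) (π : PricingPolicy.{u, v} X pmax)
    (x : ℕ → X) (t : ℕ) :
    Measurable fun z : (ℕ → ℝ) × π.Seed => I.postedPrice π z.2 x z.1 t :=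
  (π.measurable_price t).comp
    (measurable_snd.prodMk (measurable_const.prodMk (I.measurable_outcomes π x t)))

theorem measurable_tail (I : PricingInstance X pmax) : Measurable I.tail :=
  measurable_const.sub (monotone_cdf I.noise).measurable

/-- The law of the purchase indicators for an atomless noise. -/
theorem infinitePi_outcomes (I : PricingInstance X pmax) (π : PricingPolicy.{u, v} X pmax)
    (hI : ∀ z, I.noise.real (Ici z) = I.tail z) (x : ℕ → X) (s : π.Seed) (t : ℕ)
    (y : Fin t → Bool) :
    (Measure.infinitePi fun _ : ℕ => I.noise).real {ξ | I.outcomes π s x ξ t = y}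
      = treeMass (I.saleKernel π x s) t y := by
  -- Extending the history to an infinite sequence lets all its prefixes be written uniformly in the
  -- induction.
  obtain ⟨Y, rfl⟩ : ∃ Y : ℕ → Bool, y = fun i : Fin t => Y i :=
    ⟨fun i => if h : i < t then y ⟨i, h⟩ else false, by
      funext i
      simp⟩
  have hset : {ξ : ℕ → ℝ | I.outcomes π s x ξ t = fun i : Fin t => Y i}
      = Set.pi (Finset.range t : Set ℕ) fun i => {ξ : ℝ |
        decide (π.price i s (fun j => x j) (fun j => Y j) ≤ I.utility (x i) + ξ) = Y i} := by
    ext ξ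
    rw [mem_ofPred_eq, outcomes_eq_iff, Set.mem_pi]
    simp
  have hIci : ∀ p c : ℝ, {ξ : ℝ | p ≤ c + ξ} = Ici (p - c) := fun p c => by
    ext ξ
    simp only [mem_ofPred_eq, mem_Ici]
    constructor <;> intro <;> linarith
  have hone : ∀ (p c : ℝ) (b : Bool), MeasurableSet {ξ : ℝ | decide (p ≤ c + ξ) = b} ∧
      I.noise.real {ξ : ℝ | decide (p ≤ c + ξ) = b}
        = if b then I.tail (p - c) else 1 - I.tail (p - c) := fun p c b => by
    cases b
    · have : {ξ : ℝ | decide (p ≤ c + ξ) = false} = (Ici (p - c))ᶜ := by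
        rw [← hIci]
        ext ξ
        simp
      rw [this]
      refine ⟨measurableSet_Ici.compl, ?_⟩
      rw [probReal_compl_eq_one_sub measurableSet_Ici, hI]
      simp
    · have : {ξ : ℝ | decide (p ≤ c + ξ) = true} = Ici (p - c) := by
        rw [← hIci]
        ext ξ
        simp
      rw [this]
      refine ⟨measurableSet_Ici, ?_⟩
      rw [hI]
      simp
  rw [hset, measureReal_def, Measure.infinitePi_pi _ fun i _ => (hone _ _ _).1,
    ENNReal.toReal_prod]
  change ∏ i ∈ Finset.range t, I.noise.real _ = _
  simp only [(hone _ _ _).2]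
  induction t with
  | zero => simp [treeMass]
  | succ t ih =>
    rw [Finset.prod_range_succ, ih]
    · rfl
    · ext ξ
      rw [mem_ofPred_eq, outcomes_eq_iff, Set.mem_pi]
      simp

theorem abs_indexRevenue_le (I : PricingInstance X pmax) (a : ℝ) {p : ℝ} (hp : p ∈ Icc 0 pmax) :
    |I.indexRevenue a p| ≤ pmax := by
  rw [indexRevenue, tail, abs_mul, abs_of_nonneg hp.1,
    abs_of_nonneg (sub_nonneg.2 (cdf_le_one _ _))]
  have h1 := cdf_nonneg I.noise (p - a)
  have h2 := cdf_le_one I.noise (p - a)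
  nlinarith [hp.1, hp.2]

/-- For deterministic contexts and atomless noise, the regret is the average over the seed of
expectations over adaptive coin flips. -/
theorem regret_eq_integral_treeExp [MeasurableSingletonClass X] (I : PricingInstance X pmax)
    (π : PricingPolicy.{u, v} X pmax) (hI : ∀ z, I.noise.real (Ici z) = I.tail z) (x : ℕ → X)
    (hx : I.contextLaw = Measure.dirac x) (T : ℕ) :
    Integrable (fun s => ∑ t ∈ Finset.range T, treeExp (I.saleKernel π x s) t fun y =>
        I.optRevenue (x t) - I.revenue (x t) (π.price t s (fun i => x i) y)) π.seedLaw ∧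
      I.regret π T = ∫ s, ∑ t ∈ Finset.range T, treeExp (I.saleKernel π x s) t (fun y =>
        I.optRevenue (x t) - I.revenue (x t) (π.price t s (fun i => x i) y)) ∂π.seedLaw := by
  have hrev : ∀ t, Measurable (I.revenue (x t)) := fun t => by
    unfold revenue indexRevenue
    exact measurable_id.mul (I.measurable_tail.comp (measurable_id.sub_const _))
  have hint : ∀ t, Integrable (fun z : (ℕ → ℝ) × π.Seed =>
      I.optRevenue (x t) - I.revenue (x t) (I.postedPrice π z.2 x z.1 t))
      ((Measure.infinitePi fun _ : ℕ => I.noise).prod π.seedLaw) := fun t => by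
    refine (integrable_const _).sub (Integrable.of_bound (C := pmax)
      ((hrev t).comp (I.measurable_postedPrice π x t)).aestronglyMeasurable ?_)
    exact Filter.Eventually.of_forall fun z => I.abs_indexRevenue_le _ (π.price_mem t _ _ _)
  have hint' := integrable_finsetSum (Finset.range T) fun t _ => hint t
  have hinner : ∀ s : π.Seed, ∫ ξ, ∑ t ∈ Finset.range T,
      (I.optRevenue (x t) - I.revenue (x t) (I.postedPrice π s x ξ t))
        ∂(Measure.infinitePi fun _ : ℕ => I.noise)
      = ∑ t ∈ Finset.range T, treeExp (I.saleKernel π x s) t fun y =>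
        I.optRevenue (x t) - I.revenue (x t) (π.price t s (fun i => x i) y) := by
    intro s
    have hmeas : ∀ t, Measurable fun ξ : ℕ → ℝ => I.outcomes π s x ξ t := fun t =>
      (I.measurable_outcomes π x t).comp (measurable_id.prodMk measurable_const)
    have hone : ∀ t, Integrable (fun ξ => I.optRevenue (x t)
        - I.revenue (x t) (I.postedPrice π s x ξ t)) (Measure.infinitePi fun _ : ℕ => I.noise) :=
      fun t => by
        refine (integrable_const _).sub (Integrable.of_bound (C := pmax)
          ((hrev t).comp ((I.measurable_postedPrice π x t).comp
            (measurable_id.prodMk measurable_const))).aestronglyMeasurable ?_)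
        exact Filter.Eventually.of_forall fun z => I.abs_indexRevenue_le _ (π.price_mem t _ _ _)
    rw [integral_finsetSum _ fun t _ => hone t]
    refine Finset.sum_congr rfl fun t _ => ?_
    have h := integral_map (μ := Measure.infinitePi fun _ : ℕ => I.noise) (hmeas t).aemeasurable
      (f := fun y => I.optRevenue (x t) - I.revenue (x t) (π.price t s (fun i => x i) y))
      (measurable_of_finite _).aestronglyMeasurable
    have : IsProbabilityMeasure ((Measure.infinitePi fun _ : ℕ => I.noise).map
      fun ξ : ℕ → ℝ => I.outcomes π s x ξ t) := Measure.isProbabilityMeasure_map (hmeas t).aemeasurable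
    rw [integral_fintype (Integrable.of_finite)] at h
    unfold postedPrice
    rw [← h, treeExp]
    refine Finset.sum_congr rfl fun y _ => ?_
    rw [map_measureReal_apply (hmeas t) (measurableSet_singleton y), smul_eq_mul,
      ← I.infinitePi_outcomes π hI]
    rfl
  constructor
  · exact hint'.integral_prod_right.congr (Filter.Eventually.of_forall fun s => hinner s)
  · rw [regret, jointLaw, hx, Measure.dirac_prod,
      (measurableEmbedding_prodMk_left x).integral_map]
    simp only
    rw [integral_prod_symm _ hint']
    exact integral_congr_ae (Filter.Eventually.of_forall fun s => hinner s)

end PricingInstance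

/-! ### The Assouad argument -/

/-- Flipping one coordinate of a Boolean vector. -/
def flipCoord {K : ℕ} (j : Fin K) : Equiv.Perm (Fin K → Bool) :=
  Function.Involutive.toPerm (fun w => Function.update w j (!w j)) fun w => by simp

theorem flipCoord_apply {K : ℕ} (j : Fin K) (w : Fin K → Bool) :
    flipCoord j w = Function.update w j (!w j) := rfl

/-- **Assouad's lemma** for adaptive coin flips: if distinguishing the coordinates of the hidden
sign vector requires deviating from the reference action, and not deviating is costly on the wrong
side of it, then the total loss, averaged over the sign vectors, is of order `d ^ 2 * T`. -/
theorem assouad_tree {K T : ℕ} (hK : 0 < K) (k : ℕ → Fin K)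
    (hcount : ∀ j, (((Finset.range T).filter fun t => k t = j).card : ℝ) ≤ 2 * T / K)
    {d : ℝ} (hd4 : 256 * (d ^ 4 * T) ≤ K)
    {q : (Fin K → Bool) → (t : ℕ) → (Fin t → Bool) → ℝ} (hq : ∀ w, IsTreeKernel (q w))
    (e : (t : ℕ) → (Fin t → Bool) → ℝ) (δ : Fin K → (t : ℕ) → (Fin t → Bool) → ℝ)
    (hδ : ∀ w j t y, (q w t y - q (flipCoord j w) t y) ^ 2 ≤ δ j t y)
    (hδe : ∀ t y, ∑ j, δ j t y ≤ 4 * d ^ 2 * e t y ^ 2)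
    (hmid : ∀ w j t y, q w t y ≠ q (flipCoord j w) t y → q w t y ∈ Icc (1 / 4 : ℝ) (3 / 4))
    {l : (Fin K → Bool) → (t : ℕ) → (Fin t → Bool) → ℝ}
    (hl₀ : ∀ w t y, 0 ≤ l w t y)
    (hl₁ : ∀ w t y, boolSign (w (k t)) * e t y ≤ 0 → d ^ 2 / 5120 ≤ l w t y)
    (hl₂ : ∀ w t y, 1 / 160 * e t y ^ 2 - d ^ 2 / 80 ≤ l w t y) :
    2 ^ K * (d ^ 2 * T / 81920) ≤ ∑ w, ∑ t ∈ Finset.range T, treeExp (q w) t (l w t) := by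
  set R := ∑ w, ∑ t ∈ Finset.range T, treeExp (q w) t (l w t) with hR
  set S := ∑ w, ∑ t ∈ Finset.range T, treeExp (q w) t (fun y => e t y ^ 2) with hS
  set Z : (Fin K → Bool) → Fin K → ℝ := fun w j =>
    ∑ s ∈ Finset.range T, treeExp (q w) s (δ j s) with hZ
  have hcard : (Finset.univ : Finset (Fin K → Bool)).card = 2 ^ K := by simp
  have hδ0 : ∀ j t y, 0 ≤ δ j t y := fun j t y =>
    (sq_nonneg _).trans (hδ (fun _ => true) j t y)
  have hE0 : ∀ w j s, 0 ≤ treeExp (q w) s (δ j s) := fun w j s =>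
    Finset.sum_nonneg fun y _ => mul_nonneg (treeMass_nonneg (hq w) s y) (hδ0 j s y)
  -- Small regret forces small total squared deviation `S`, hence by `hZS` little total information.
  have hSR : 1 / 160 * S - 2 ^ K * (T * (d ^ 2 / 80)) ≤ R := by
    have h : ∀ w, ∀ t ∈ Finset.range T,
        1 / 160 * treeExp (q w) t (fun y => e t y ^ 2) - d ^ 2 / 80 ≤ treeExp (q w) t (l w t) := by
      intro w t _
      rw [← treeExp_const_mul, ← treeExp_sub_const]
      exact treeExp_mono (hq w) (hl₂ w t)
    have h2 := Finset.sum_le_sum (s := Finset.univ) fun w _ => Finset.sum_le_sum (h w)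
    simp only [Finset.sum_sub_distrib, ← Finset.mul_sum, Finset.sum_const, Finset.card_range,
      hcard, nsmul_eq_mul] at h2
    push_cast at h2
    rw [mul_left_comm]
    exact h2
  have hZS : ∑ w, ∑ j, Z w j ≤ 4 * d ^ 2 * S := by
    rw [hS, Finset.mul_sum]
    refine Finset.sum_le_sum fun w _ => ?_
    rw [hZ, Finset.sum_comm, Finset.mul_sum]
    refine Finset.sum_le_sum fun t _ => ?_
    rw [← treeExp_sum, ← treeExp_const_mul]
    exact treeExp_mono (hq w) (hδe t)
  have hround : ∀ t ∈ Finset.range T,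
      d ^ 2 / 10240 * (2 ^ K / 2 - 4 * ∑ w, Z w (k t)) ≤ ∑ w, treeExp (q w) t (l w t) := by
    intro t ht
    set j := k t with hj
    -- Read the side on which the price falls as a test for the sign `w j`: for each history it errs
    -- under `w` or under its flip.
    set f : (Fin K → Bool) → (Fin t → Bool) → ℝ := fun w y =>
      if boolSign (w j) * e t y ≤ 0 then 1 else 0 with hf
    have hf0 : ∀ w y, 0 ≤ f w y := fun w y => by
      simp only [hf]
      split_ifs <;> norm_num
    have hff : ∀ w y, 1 ≤ f w y + f (flipCoord j w) y := fun w y => by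
      simp only [hf, flipCoord_apply, Function.update_self, boolSign_not]
      split_ifs with h1 h2
      · norm_num
      · norm_num
      · norm_num
      · linarith
    have hlf : ∀ w, d ^ 2 / 5120 * treeExp (q w) t (f w) ≤ treeExp (q w) t (l w t) := fun w => by
      rw [← treeExp_const_mul]
      refine treeExp_mono (hq w) fun y => ?_
      simp only [hf]
      split_ifs with h
      · rw [mul_one]
        exact hl₁ w t y h
      · rw [mul_zero]
        exact hl₀ w t y
    have hpair : ∀ w, 1 / 2 - 2 * (Z w j + Z (flipCoord j w) j)
        ≤ treeExp (q w) t (f w) + treeExp (q (flipCoord j w)) t (f (flipCoord j w)) := by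
      intro w
      refine le_trans ?_ (tree_test_error (hq w) (hq (flipCoord j w)) (hmid w j) t (hf0 w)
        (hf0 _) (hff w))
      have h1 : ∑ s ∈ Finset.range t,
          (treeExp (q w) s (fun y => (q w s y - q (flipCoord j w) s y) ^ 2)
            + treeExp (q (flipCoord j w)) s (fun y => (q w s y - q (flipCoord j w) s y) ^ 2))
          ≤ Z w j + Z (flipCoord j w) j := by
        rw [hZ, ← Finset.sum_add_distrib]
        refine (Finset.sum_le_sum fun s _ => add_le_add
          (treeExp_mono (hq _) (hδ w j s)) (treeExp_mono (hq _) (hδ w j s))).trans ?_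
        exact Finset.sum_le_sum_of_subset_of_nonneg
          (Finset.range_subset_range.2 (Finset.mem_range.1 ht).le)
          fun s _ _ => add_nonneg (hE0 _ _ _) (hE0 _ _ _)
      linarith
    have hsum := Finset.sum_le_sum (s := Finset.univ) fun w _ => hpair w
    have e1 := Equiv.sum_comp (flipCoord j) fun w => treeExp (q w) t (f w)
    have e2 := Equiv.sum_comp (flipCoord j) fun w => Z w j
    rw [Finset.sum_add_distrib, e1, Finset.sum_sub_distrib, ← Finset.mul_sum,
      Finset.sum_add_distrib, e2, Finset.sum_const, hcard, nsmul_eq_mul] at hsum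
    push_cast at hsum
    have hlsum := Finset.sum_le_sum (s := Finset.univ) fun w _ => hlf w
    rw [← Finset.mul_sum] at hlsum
    refine le_trans ?_ hlsum
    have : 0 ≤ d ^ 2 / 10240 := by positivity
    calc d ^ 2 / 10240 * (2 ^ K / 2 - 4 * ∑ w, Z w j)
        ≤ d ^ 2 / 10240 * (2 * ∑ w, treeExp (q w) t (f w)) := by
          refine mul_le_mul_of_nonneg_left ?_ this
          linarith
      _ = d ^ 2 / 5120 * ∑ w, treeExp (q w) t (f w) := by ring
  have hK' : (0 : ℝ) < K := by exact_mod_cast hK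
  -- Each sign is at stake in at most `2T/K` rounds, so only the average information per sign
  -- enters.
  have hfib : ∑ t ∈ Finset.range T, ∑ w, Z w (k t) ≤ 2 * T / K * ∑ w, ∑ j, Z w j := by
    rw [Finset.sum_comm, Finset.mul_sum]
    refine Finset.sum_le_sum fun w _ => ?_
    rw [← Finset.sum_fiberwise (Finset.range T) k, Finset.mul_sum]
    refine Finset.sum_le_sum fun j _ => ?_
    rw [Finset.sum_congr rfl fun t ht => by rw [(Finset.mem_filter.1 ht).2], Finset.sum_const,
      nsmul_eq_mul]
    exact mul_le_mul_of_nonneg_right (hcount j) (Finset.sum_nonneg fun s _ => hE0 w j s)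
  have hmain : d ^ 2 / 10240 * (T * (2 ^ K / 2) - 4 * (2 * T / K * (4 * d ^ 2 * S))) ≤ R := by
    have h1 := Finset.sum_le_sum hround
    rw [Finset.sum_comm, ← hR, ← Finset.mul_sum, Finset.sum_sub_distrib, ← Finset.mul_sum,
      Finset.sum_const, Finset.card_range, nsmul_eq_mul] at h1
    refine le_trans ?_ h1
    have h2 : 2 * (T : ℝ) / K * ∑ w, ∑ j, Z w j ≤ 2 * T / K * (4 * d ^ 2 * S) := by gcongr
    refine mul_le_mul_of_nonneg_left ?_ (by positivity)
    linarith
  have hR0 : 0 ≤ R := Finset.sum_nonneg fun w _ => Finset.sum_nonneg fun t _ =>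
    Finset.sum_nonneg fun y _ => mul_nonneg (treeMass_nonneg (hq w) t y) (hl₀ w t y)
  have hκ : d ^ 4 * T / K ≤ 1 / 256 := by
    rw [div_le_iff₀ hK']
    linarith
  have hW : (0 : ℝ) ≤ 2 ^ K * (d ^ 2 * T) := by positivity
  have hS' : S ≤ 160 * R + 2 * (2 ^ K * (d ^ 2 * T)) := by linarith
  -- `R` now bounds itself: after substitution it appears on the right with coefficient `-1/512` and
  -- is absorbed on the left, while half of the main term survives.
  have hprod : d ^ 4 * T / K * S ≤ 1 / 256 * (160 * R + 2 * (2 ^ K * (d ^ 2 * T))) :=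
    (mul_le_mul_of_nonneg_left hS' (by positivity)).trans
      (mul_le_mul_of_nonneg_right hκ (by positivity))
  have hexp : d ^ 2 / 10240 * (T * (2 ^ K / 2) - 4 * (2 * T / K * (4 * d ^ 2 * S)))
      = 2 ^ K * (d ^ 2 * T) / 20480 - 1 / 320 * (d ^ 4 * T / K * S) := by
    field_simp
    ring
  rw [hexp] at hmain
  linarith

/-! ### Round-robin instances and their regret -/

/-- The number of rounds below `T` in a residue class modulo `K ≤ T`. -/
theorem card_filter_mod_le {K T : ℕ} (hK : 0 < K) (hKT : K ≤ T) (j : ℕ) :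
    (((Finset.range T).filter fun t => t % K = j).card : ℝ) ≤ 2 * T / K := by
  have h1 : ((Finset.range T).filter fun t => t % K = j).card ≤ T / K + 1 := by
    rw [← Finset.card_range (T / K + 1)]
    refine Finset.card_le_card_of_injOn (· / K) (fun t ht => ?_) fun t ht t' ht' h => ?_
    · have := Finset.mem_range.1 (Finset.mem_filter.1 ht).1
      exact Finset.mem_coe.2 (Finset.mem_range.2 (Nat.lt_succ_of_le (Nat.div_le_div_right this.le)))
    · rw [← Nat.div_add_mod t K, ← Nat.div_add_mod t' K, (Finset.mem_filter.1 ht).2,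
        (Finset.mem_filter.1 ht').2]
      simp only at h
      rw [h]
  have hK' : (0 : ℝ) < K := by exact_mod_cast hK
  have h2 : ((T / K : ℕ) : ℝ) ≤ T / K := Nat.cast_div_le
  have h3 : (1 : ℝ) ≤ T / K := by
    rw [le_div_iff₀ hK', one_mul]
    exact_mod_cast hKT
  have h4 : (((Finset.range T).filter fun t => t % K = j).card : ℝ) ≤ (T / K : ℕ) + 1 := by
    exact_mod_cast h1
  rw [mul_div_assoc]
  linarith

/-- The round-robin schedule of the wiggles. -/
def roundRobin {K : ℕ} (hK : 0 < K) (t : ℕ) : Fin K := ⟨t % K, Nat.mod_lt t hK⟩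

section RoundRobin

variable {β ε : ℝ} {K : ℕ}

/-- The instance whose tail carries wiggles with signs `w` and whose contexts visit the critical
contexts of all the wiggles periodically. -/
def wiggleInstance (hP : ∀ w : Fin K → Bool, IsSmallPerturbation (wiggleSum β ε K w)) (hK : 0 < K)
    (w : Fin K → Bool) : PricingInstance ℝ 1 :=
  perturbedInstance (hP w) (fun t => wiggleContext K (roundRobin hK t))
    fun _ => wiggleContext_mem _

/-- Flipping one sign changes the perturbation by twice the corresponding wiggle. -/
theorem wiggleSum_sub_flipCoord (w : Fin K → Bool) (j : Fin K) (z : ℝ) :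
    wiggleSum β ε K w z - wiggleSum β ε K (flipCoord j w) z
      = 2 * boolSign (w j) * wiggle β ε K j z := by
  rw [wiggleSum, wiggleSum, ← Finset.sum_sub_distrib, Finset.sum_eq_single j]
  · rw [flipCoord_apply, Function.update_self, boolSign_not]
    ring
  · intro i _ hi
    rw [flipCoord_apply, Function.update_of_ne hi, sub_self]
  · simp

/-- Some sign vector makes the policy suffer regret of order `d ^ 2 * T`. -/
theorem exists_wiggleInstance_regret_ge
    (hP : ∀ w : Fin K → Bool, IsSmallPerturbation (wiggleSum β ε K w)) (hε : 0 ≤ ε) (hK : 0 < K)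
    {T : ℕ} (hKT : K ≤ T) (hd4 : 256 * ((ε * wiggleScale K ^ (β - 1)) ^ 4 * T) ≤ K)
    (π : PricingPolicy.{u, 0} ℝ 1) :
    ∃ w, (ε * wiggleScale K ^ (β - 1)) ^ 2 * T / 81920 ≤ (wiggleInstance hP hK w).regret π T := by
  set d := ε * wiggleScale K ^ (β - 1) with hd
  set x : ℕ → ℝ := fun t => wiggleContext K (roundRobin hK t) with hx
  have htail : ∀ w z, (wiggleInstance hP hK w).tail z = rampTail z + wiggleSum β ε K w z :=
    fun w z => perturbedInstance_tail _ _ _ z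
  have hreg := fun w => (wiggleInstance hP hK w).regret_eq_integral_treeExp π
    (fun z => (perturbedCDF_real_Ici (hP w) z).trans (htail w z).symm) x rfl T
  -- With the seed frozen the policy is deterministic; since the bound on the sum over `w` is
  -- uniform in the seed, it can be integrated before a sign vector is chosen.
  have hseed : ∀ s : π.Seed, 2 ^ K * (d ^ 2 * T / 81920) ≤ ∑ w, ∑ t ∈ Finset.range T,
      treeExp ((wiggleInstance hP hK w).saleKernel π x s) t fun y =>
        (wiggleInstance hP hK w).optRevenue (x t)
          - (wiggleInstance hP hK w).revenue (x t) (π.price t s (fun i => x i) y) := by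
    intro s
    set z : (t : ℕ) → (Fin t → Bool) → ℝ := fun t y => π.price t s (fun i => x i) y - x t with hz
    have hsale : ∀ w t y, (wiggleInstance hP hK w).saleKernel π x s t y
        = rampTail (z t y) + wiggleSum β ε K w (z t y) := fun w t y => htail w _
    have hgrowth : ∀ w t, ∃ q,
        |q - (1 / 2 - wiggleCenter K (roundRobin hK t))| ≤ d ∧
        d / 8 ≤ boolSign (w (roundRobin hK t)) * (q - (1 / 2 - wiggleCenter K (roundRobin hK t))) ∧
        ∀ p ∈ Icc (0 : ℝ) 1, 1 / 80 * (p - q) ^ 2 ≤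
          (wiggleInstance hP hK w).optRevenue (x t)
            - (wiggleInstance hP hK w).revenue (x t) p := fun w t => by
      obtain ⟨q, hq, hg⟩ := perturbedInstance_exists_regret_growth (hP w) x
        (fun _ => wiggleContext_mem _) (wiggleContext_mem (roundRobin hK t))
      obtain ⟨h1, h2⟩ := firstOrder_wiggleSum (hP w) hε (roundRobin hK t) hq
      exact ⟨q, h1, h2, hg⟩
    have hez : ∀ t y, z t y - wiggleCenter K (roundRobin hK t)
        = π.price t s (fun i => x i) y - (1 / 2 - wiggleCenter K (roundRobin hK t)) :=
      fun t y => by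
        simp only [hz, hx, wiggleContext]
        ring
    refine assouad_tree hK (roundRobin hK) (fun j => ?_) hd4
      (fun w => (wiggleInstance hP hK w).isTreeKernel_saleKernel π x s)
      (fun t y => z t y - wiggleCenter K (roundRobin hK t))
      (fun j t y => 4 * wiggle β ε K j (z t y) ^ 2) (fun w j t y => ?_) (fun t y => ?_)
      (fun w j t y hne => ?_) (fun w t y => ?_) (fun w t y hwrong => ?_) (fun w t y => ?_)
    · have : ((Finset.range T).filter fun t => roundRobin hK t = j)
          = (Finset.range T).filter fun t => t % K = j :=
        Finset.filter_congr fun t _ => by simp [roundRobin, Fin.ext_iff]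
      rw [this]
      exact card_filter_mod_le hK hKT j
    · rw [hsale, hsale, add_sub_add_left_eq_sub, wiggleSum_sub_flipCoord, mul_pow, mul_pow,
        ← sq_abs (boolSign _), abs_boolSign]
      norm_num
    · rw [← Finset.mul_sum, mul_assoc]
      exact mul_le_mul_of_nonneg_left (sum_wiggle_sq_le hε _ _) (by norm_num)
    · rw [hsale, hsale, ne_eq, ← sub_eq_zero, add_sub_add_left_eq_sub,
        wiggleSum_sub_flipCoord] at hne
      -- The sale probability depends on the `j`-th sign only inside that wiggle, hence near the
      -- origin, where it is close to `1/2`.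
      have h1 : |z t y - wiggleCenter K j| ≤ wiggleScale K :=
        le_of_not_gt fun h => hne (by rw [wiggle_eq_zero h, mul_zero])
      have h2 := abs_le.1 (h1.trans (wiggleScale_le j))
      have h3 := abs_le.1 (abs_wiggleCenter_le j)
      have h4 := abs_le.1 ((hP w).abs_apply_le (z t y))
      rw [hsale, rampTail.eq_of_abs_le (abs_le.2 ⟨by linarith, by linarith⟩)]
      constructor <;> linarith
    · obtain ⟨q, -, -, hg⟩ := hgrowth w t
      exact le_trans (by positivity) (hg _ (π.price_mem _ _ _ _))
    · obtain ⟨q, -, hq, hg⟩ := hgrowth w t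
      refine le_trans ?_ (hg _ (π.price_mem _ _ _ _))
      simp only [hez] at hwrong
      have hd0 : 0 ≤ d := by
        have hs := wiggleScale_pos (roundRobin hK t)
        positivity
      -- A price on the wrong side of the reference misses `q` by at least `d/8`; the growth
      -- constant `1/80` turns this into `d²/5120`.
      have h1 : d / 8 ≤ |q - π.price t s (fun i => x i) y| := by
        refine le_trans ?_ (le_abs_self _ |>.trans (abs_mul (boolSign (w (roundRobin hK t)))
          (q - π.price t s (fun i => x i) y)).le |>.trans (by rw [abs_boolSign, one_mul]))
        linarith
      have h2 : (d / 8) ^ 2 ≤ (q - π.price t s (fun i => x i) y) ^ 2 := by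
        rw [← sq_abs (q - _)]
        gcongr
      rw [sub_sq_comm]
      linarith
    · obtain ⟨q, hq, -, hg⟩ := hgrowth w t
      refine le_trans ?_ (hg _ (π.price_mem _ _ _ _))
      rw [hez]
      -- The deviation satisfies `e² ≤ 2 (p - q)² + 2 d²`, because `q` is within `d` of the
      -- reference price.
      have h1 := sq_le_sq' (neg_le_of_abs_le hq) (le_of_abs_le hq)
      nlinarith [sq_nonneg ((π.price t s (fun i => x i) y - q)
        - (q - (1 / 2 - wiggleCenter K (roundRobin hK t))))]
  by_contra hcon
  push Not at hcon
  have hlt : ∑ w, (wiggleInstance hP hK w).regret π T < 2 ^ K * (d ^ 2 * T / 81920) := by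
    refine (Finset.sum_lt_sum_of_nonempty Finset.univ_nonempty fun w _ => hcon w).trans_eq ?_
    simp
  have hge : 2 ^ K * (d ^ 2 * T / 81920) ≤ ∑ w, (wiggleInstance hP hK w).regret π T := by
    rw [Finset.sum_congr rfl fun w _ => (hreg w).2, ← integral_finsetSum _ fun w _ => (hreg w).1]
    have h := integral_mono (μ := π.seedLaw) (integrable_const _)
      (integrable_finsetSum Finset.univ fun w _ => (hreg w).1) hseed
    simpa using h
  exact absurd hge (not_le.2 hlt)

end RoundRobin

/-! ### Choice of the number of wiggles and conclusion -/

/-- The number of wiggles used over the horizon `T`. -/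
theorem exists_number_of_wiggles {β : ℝ} (hβ : 2 ≤ β) {T : ℕ} (hT : 1 ≤ T) :
    ∃ K : ℕ, 0 < K ∧ K ≤ T ∧ (T : ℝ) ≤ (K : ℝ) ^ (4 * β - 3) ∧
      (K : ℝ) ≤ 2 * (T : ℝ) ^ (1 / (4 * β - 3)) := by
  have hT' : (1 : ℝ) ≤ T := by exact_mod_cast hT
  have ha : 0 < 4 * β - 3 := by linarith
  have h1 : (1 : ℝ) ≤ (T : ℝ) ^ (1 / (4 * β - 3)) := Real.one_le_rpow hT' (by positivity)
  refine ⟨⌈(T : ℝ) ^ (1 / (4 * β - 3))⌉₊, Nat.ceil_pos.2 (by linarith), Nat.ceil_le.2 ?_, ?_, ?_⟩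
  · refine (Real.rpow_le_rpow_of_exponent_le hT' (y := 1 / (4 * β - 3)) (z := 1) ?_).trans_eq
      (Real.rpow_one _)
    rw [div_le_one ha]
    linarith
  · calc (T : ℝ) = ((T : ℝ) ^ (1 / (4 * β - 3))) ^ (4 * β - 3) := by
          rw [← Real.rpow_mul (by linarith), one_div_mul_cancel ha.ne', Real.rpow_one]
      _ ≤ _ := Real.rpow_le_rpow (by linarith) (Nat.le_ceil _) ha.le
  · have := Nat.ceil_lt_add_one (show 0 ≤ (T : ℝ) ^ (1 / (4 * β - 3)) by linarith)
    linarith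

/-- With `K` wiggles the per-round separation is too small to be detected for free. -/
theorem wiggle_information_le {β ε : ℝ} (hβ : 2 ≤ β) (hε : 0 ≤ ε) (hε4 : ε ≤ 1 / 4) {K T : ℕ}
    (hK : 0 < K) (hT : (T : ℝ) ≤ (K : ℝ) ^ (4 * β - 3)) :
    256 * ((ε * wiggleScale K ^ (β - 1)) ^ 4 * T) ≤ K := by
  have hK' : (0 : ℝ) < K := by exact_mod_cast hK
  have hs : 0 < wiggleScale K := wiggleScale_pos ⟨0, hK⟩
  have hsK : wiggleScale K ≤ (K : ℝ)⁻¹ := by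
    rw [wiggleScale, ← one_div]
    exact one_div_le_one_div_of_le hK' (by linarith)
  have h1 : wiggleScale K ^ (β - 1) ≤ (K : ℝ)⁻¹ ^ (β - 1) :=
    Real.rpow_le_rpow hs.le hsK (by linarith)
  -- The threshold `ε ≤ 1/4` is chosen because `256 * (1/4)^4 = 1`.
  have h2 : (ε * wiggleScale K ^ (β - 1)) ^ 4 ≤ (1 / 4 * (K : ℝ)⁻¹ ^ (β - 1)) ^ 4 := by gcongr
  have h3 : ((K : ℝ)⁻¹ ^ (β - 1)) ^ 4 * (K : ℝ) ^ (4 * β - 3) = K := by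
    rw [Real.inv_rpow hK'.le, ← Real.rpow_neg hK'.le, ← Real.rpow_natCast, ← Real.rpow_mul hK'.le,
      ← Real.rpow_add hK']
    conv_rhs => rw [← Real.rpow_one (K : ℝ)]
    congr 1
    push_cast
    ring
  calc 256 * ((ε * wiggleScale K ^ (β - 1)) ^ 4 * T)
      ≤ 256 * ((1 / 4 * (K : ℝ)⁻¹ ^ (β - 1)) ^ 4 * (K : ℝ) ^ (4 * β - 3)) := by gcongr
    _ = ((K : ℝ)⁻¹ ^ (β - 1)) ^ 4 * (K : ℝ) ^ (4 * β - 3) := by ring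
    _ = K := h3

/-- The separation achieved by the wiggles has the advertised order in the horizon. -/
theorem wiggle_separation_ge {β ε : ℝ} (hβ : 2 ≤ β) {K T : ℕ} (hK : 0 < K) (hT : 1 ≤ T)
    (hKT : (K : ℝ) ≤ 2 * (T : ℝ) ^ (1 / (4 * β - 3))) :
    ε ^ 2 * (1 / 128) ^ (2 * β - 2) / 81920 * (T : ℝ) ^ ((2 * β - 1) / (4 * β - 3))
      ≤ (ε * wiggleScale K ^ (β - 1)) ^ 2 * T / 81920 := by
  have hT' : (0 : ℝ) < T := by exact_mod_cast hT
  have hK' : (0 : ℝ) < K := by exact_mod_cast hK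
  have ha : 0 < 4 * β - 3 := by linarith
  have hs : 0 < wiggleScale K := wiggleScale_pos ⟨0, hK⟩
  have hpos : 0 < (T : ℝ) ^ (1 / (4 * β - 3)) := Real.rpow_pos_of_pos hT' _
  have h1 : 1 / 128 * (T : ℝ) ^ (-(1 / (4 * β - 3))) ≤ wiggleScale K := by
    rw [Real.rpow_neg hT'.le, wiggleScale, ← one_div, one_div_mul_one_div]
    exact one_div_le_one_div_of_le (by positivity) (by linarith)
  have h2 : (1 / 128 * (T : ℝ) ^ (-(1 / (4 * β - 3)))) ^ (2 * β - 2)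
      ≤ wiggleScale K ^ (2 * β - 2) := Real.rpow_le_rpow (by positivity) h1 (by linarith)
  rw [Real.mul_rpow (by norm_num) (by positivity), ← Real.rpow_mul hT'.le] at h2
  have h3 : (wiggleScale K ^ (β - 1)) ^ 2 = wiggleScale K ^ (2 * β - 2) := by
    rw [← Real.rpow_natCast, ← Real.rpow_mul hs.le]
    congr 1
    push_cast
    ring
  have h4 : (T : ℝ) ^ ((2 * β - 1) / (4 * β - 3))
      = (T : ℝ) ^ (-(1 / (4 * β - 3)) * (2 * β - 2)) * T := by
    conv_rhs => rw [← Real.rpow_one (T : ℝ), ← Real.rpow_mul hT'.le, one_mul,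
      ← Real.rpow_add hT']
    congr 1
    rw [div_eq_mul_inv, one_div]
    linear_combination mul_inv_cancel₀ ha.ne'
  rw [mul_pow, h3, h4]
  have h5 := mul_le_mul_of_nonneg_left h2 (show 0 ≤ ε ^ 2 * T / 81920 by positivity)
  calc _ = ε ^ 2 * T / 81920 * ((1 / 128) ^ (2 * β - 2)
        * (T : ℝ) ^ (-(1 / (4 * β - 3)) * (2 * β - 2))) := by ring
    _ ≤ _ := h5
    _ = _ := by ring

end

theorem theorem2 (β : ℝ) (hβ : 2 ≤ β) :
    ∃ cβ : ℝ, 0 < cβ ∧ ∃ Lg σr Lr a b : ℝ, ∃ T₀ : ℕ, ∀ T : ℕ, T₀ ≤ T →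
      (∀ π : PricingPolicy.{u, 0} ℝ 1, ∃ I : PricingInstance ℝ 1,
        I.IsLowerBoundNormalized β Lg σr Lr a b ∧
          cβ * (T : ℝ) ^ ((2 * β - 1) / (4 * β - 3)) ≤ I.regret π T) ∧
      ((cβ * (T : ℝ) ^ ((2 * β - 1) / (4 * β - 3)) : ℝ) : EReal) ≤
        ⨅ π : PricingPolicy.{u, 0} ℝ 1,
          ⨆ I : {I : PricingInstance ℝ 1 // I.IsLowerBoundNormalized β Lg σr Lr a b},
            ((I.1.regret π T : ℝ) : EReal) := by
  choose C hC using fun n =>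
    exists_bound_iteratedDeriv unitWiggle.contDiff unitWiggle.hasCompactSupport n
  choose D hD using rampTail.exists_bound
  have hC0 : ∀ n, 0 ≤ C n := fun n => (abs_nonneg _).trans (hC n 0)
  have hD0 : ∀ n, 0 ≤ D n := fun n => (abs_nonneg _).trans (hD n 0)
  set B : ℝ := 1 + C 0 + C 1 + C 2 with hB
  have hB1 : 1 ≤ B := by linarith [hC0 0, hC0 1, hC0 2]
  have hCB : ∀ n ≤ 2, ∀ z, |iteratedDeriv n unitWiggle z| ≤ B := fun n hn z => by
    refine (hC n z).trans ?_
    interval_cases n <;> linarith [hC0 0, hC0 1, hC0 2]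
  -- The amplitude depends only on the fixed profile `unitWiggle`, so neither `K` nor `T` enters the
  -- constants.
  set ε : ℝ := 1 / (2048 * B) with hε
  have hε0 : 0 < ε := by positivity
  have hεB : ε * B ≤ 1 / 2048 := by
    rw [hε]
    field_simp
    rfl
  have hε4 : ε ≤ 1 / 4 := by nlinarith
  -- The range reaches order `⌊β⌋₊ + 1`, one above the regularity required, as the interpolation of
  -- Taylor remainders needs both orders. `D n` bounds the derivative of order `n + 1` of the base
  -- tail.
  set M : ℝ := 1 + ∑ n ∈ Finset.range (⌊β⌋₊ + 2), (C n + D n) with hM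
  have hCM : ∀ n ≤ ⌊β⌋₊ + 1, C n + D n + 1 ≤ M := fun n hn => by
    have := Finset.single_le_sum (f := fun n => C n + D n)
      (fun i _ => add_nonneg (hC0 i) (hD0 i)) (Finset.mem_range.2 (by omega : n < ⌊β⌋₊ + 2))
    linarith
  have hM0 : 0 < M := by linarith [hCM 0 (by omega), hC0 0, hD0 0]
  refine ⟨ε ^ 2 * (1 / 128) ^ (2 * β - 2) / 81920, by positivity, 4 * M, 1 / 40, 32, 7 / 16,
    9 / 16, 1, fun T hT => ?_⟩
  have key : ∀ π : PricingPolicy.{u, 0} ℝ 1, ∃ I : PricingInstance ℝ 1,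
      I.IsLowerBoundNormalized β (4 * M) (1 / 40) 32 (7 / 16) (9 / 16) ∧
        ε ^ 2 * (1 / 128) ^ (2 * β - 2) / 81920 * (T : ℝ) ^ ((2 * β - 1) / (4 * β - 3))
          ≤ I.regret π T := by
    intro π
    obtain ⟨K, hK, hKT, hTK, hK2⟩ := exists_number_of_wiggles hβ hT
    have hP : ∀ w : Fin K → Bool, IsSmallPerturbation (wiggleSum β ε K w) :=
      isSmallPerturbation_wiggleSum hβ hε0.le hCB hεB
    obtain ⟨w, hw⟩ := exists_wiggleInstance_regret_ge hP hε0.le hK hKT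
      (wiggle_information_le hβ hε0.le hε4 hK hTK) π
    refine ⟨wiggleInstance hP hK w, ?_, (wiggle_separation_ge hβ hK hT hK2).trans hw⟩
    have hs : 0 < wiggleScale K := wiggleScale_pos ⟨0, hK⟩
    refine perturbedInstance_isLowerBoundNormalized _ _ _ (perturbedInstance_holderTail _ _ _ hβ hM0
      hs (by linarith [wiggleScale_le (⟨0, hK⟩ : Fin K)]) (fun n hn1 hn z => ?_)
      fun n hn z => ?_)
    · obtain ⟨m, rfl⟩ : ∃ m, n = m + 1 := ⟨n - 1, by omega⟩
      exact (hD m z).trans (by linarith [hCM m (by omega), hC0 m])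
    · refine (abs_iteratedDeriv_wiggleSum_le hε0.le w (hC n) z).trans ?_
      have h1 : ε * C n ≤ M := by
        have := hCM n hn
        nlinarith [hC0 n, hD0 n]
      gcongr
  refine ⟨key, le_iInf fun π => ?_⟩
  obtain ⟨I, hI, hreg⟩ := key π
  exact le_iSup_of_le ⟨I, hI⟩ (EReal.coe_le_coe_iff.2 hreg)
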